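/- Conventions. $\mathbb H^{n+1}$ is a right quaternionic vector space, $M$ a connected Riemann surface, and $*\omega(X)=\omega(J_MX)$ for 1-forms on $M$. A smooth map $f:M\to\mathbb{HP}^n$ is identified with the quaternionic line subbundle $L$, $L_p=f(p)$, of the trivial bundle $V=M\times\mathbb H^{n+1}$ with trivial connection $\nabla$. It is *holomorphic* if there is a smooth complex structure $J$ on $L$ with $*\delta_L=\delta_LJ$, where $\delta_L=\pi_L\nabla|_L\in\Omega^1(\mathrm{Hom}(L,V/L))$ and $\pi_L:V\to V/L$ is the projection. A holomorphic curve $f$ is a *Frenet curve* if there are a smooth flag $V_0=L\subset V_1\subset\dots\subset V_n=V$ of quaternionic subbundles, $\operatorname{rank}V_k=k+1$, with $\nabla\Gamma(V_k)\subset\Omega^1(V_{k+1})$ (the Frenet flag), and a smooth $S\in\Gamma(\mathrm{End}(V))$, $S^2=-1$ (the canonical complex structure), stabilizing the flag, such that the derivatives $\delta_k=\pi_{V_k}\nabla|_{V_k}$, $0\le k<n$, satisfy $*\delta_k=S\delta_k=\delta_kS$, the points at which some $\delta_k$ vanishes (Weierstrass points) are isolated, and $A V\subset L$ for $A=\tfrac14(*\nabla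 S+S\nabla S)$. If $f:M\to\mathbb{HP}^n$ is a Frenet curve not meeting a hyperplane $H\subset\mathbb H^{n+1}$, its *tangent curve* with respect to $H$ is $V_1\cap H$. For a Frenet curve $\tilde f:M\to\mathbb{HP}^{n-1}$, $n\ge1$, with line bundle $\tilde L\subset\tilde V=M\times\mathbb H^n$ and canonical complex structure $\tilde S$, $H^0(K\tilde L)$ denotes the space of smooth closed $\mathbb H^n$-valued 1-forms $\omega$ on $M$ with values in $\tilde L$ and $*\omega=\tilde S\omega$. **Theorem.** Let $\tilde f:M\to\mathbb{HP}^{n-1}$ be a Frenet curve and let $\omega\in H^0(K\tilde L)$ vanish at no point of $M$. Let $\pi:\hat M\to M$ be the universal covering. Then there is a Frenet curve $f:\hat M\to\mathbb{HP}^n$ such that 1. $f$ is a curve on $M$ with monodromy: there is a representation $\rho$ of the group of deck transformations of $\pi$ by quaternionic linear automorphisms of $\mathbb H^{n+1}$ with $f\circ\gamma=\rho(\gamma)f$ for every deck transformation $\gamma$; 2. $f$ does not meet the hyperplane $\mathbb H^n\subset\mathbb H^{n+1}=\mathbb H^n\oplus\mathbb H$, and the tangent curve of $f$ with respect to this hyperplane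 is $\tilde f\circ\pi$; 3. $df=\omega$ in the affine chart given by this hyperplane: $f=[g:1]$ for a smooth map $g:\hat M\to\mathbb H^n$ with $dg=\pi^*\omega$. -/

import Mathlib

open scoped Manifold ContDiff Topology Quaternion

namespace FrenetCurves

/-! ### Quaternionic space and projective space

`ℍ^{n+1}` is a *right* quaternionic vector space: `Module ℍᵐᵒᵖ` is scalar multiplication from
the right, submodules are right quaternionic subspaces, and `ℍᵐᵒᵖ`-linear maps are the
quaternionic linear maps. -/

/-- The right quaternionic vector space `ℍ^{n+1}`. -/
abbrev HVec (n : ℕ) : Type := Fin (n + 1) → ℍ[ℝ]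

/-- Quaternionic subspaces of `ℍ^{n+1}`. -/
abbrev HSub (n : ℕ) : Type := Submodule ℍ[ℝ]ᵐᵒᵖ (HVec n)

/-- Quaternionic linear endomorphisms of `ℍ^{n+1}`. -/
abbrev HEnd (n : ℕ) : Type := HVec n →ₗ[ℍ[ℝ]ᵐᵒᵖ] HVec n

/-- Quaternionic projective space `ℍP^n`. -/
abbrev HP (n : ℕ) : Type := Projectivization ℍ[ℝ]ᵐᵒᵖ (HVec n)

/-- The standard embedding of `ℍ^{n+1}` as the hyperplane `{x_{n+1} = 0}` of `ℍ^{n+2}`. -/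
noncomputable def hyperplaneIncl (n : ℕ) : HVec n →ₗ[ℍ[ℝ]ᵐᵒᵖ] HVec (n + 1) where
  toFun v := Fin.snoc (α := fun _ => ℍ[ℝ]) v 0
  map_add' v w := by
    ext1 i
    refine Fin.lastCases ?_ (fun j => ?_) i <;> simp
  map_smul' a v := by
    ext1 i
    refine Fin.lastCases ?_ (fun j => ?_) i <;> simp

/-! ### Calculus on a Riemann surface

A Riemann surface is a one-dimensional complex manifold, charted on `ℂ`.  As a real manifold it
has the model `𝓘(ℝ, ℂ)`.  Mathlib identifies the tangent space at `p` with `ℂ` by the preferred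
chart at `p`; as this chart is holomorphic, the complex structure `J_M` of `T_p M` is
`X ↦ Complex.I * X`.  Hence `*ω (X) = ω (Complex.I * X)` for a 1-form `ω`. -/

section Calculus

variable {M : Type*} [TopologicalSpace M] [ChartedSpace ℂ M] {n : ℕ}

/-- The trivial connection `∇` on the trivial `ℍ^{n+1}`-bundle: `nabla ψ p X = (∇_X ψ)(p)`. -/
noncomputable def nabla (ψ : M → HVec n) (p : M) : ℂ →L[ℝ] HVec n :=
  mfderiv 𝓘(ℝ, ℂ) 𝓘(ℝ, HVec n) ψ p

/-- The (real) tangent map of a map between Riemann surfaces. -/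
noncomputable def tangentMapAt {N : Type*} [TopologicalSpace N] [ChartedSpace ℂ N]
    (h : N → M) (p : N) : ℂ →L[ℝ] ℂ :=
  mfderiv 𝓘(ℝ, ℂ) 𝓘(ℝ, ℂ) h p

/-- The pullback of a vector valued 1-form `η` by a map `h`. -/
noncomputable def pullbackForm {N : Type*} [TopologicalSpace N] [ChartedSpace ℂ N]
    (h : N → M) (η : M → (ℂ →L[ℝ] HVec n)) (p : N) : ℂ →L[ℝ] HVec n :=
  (η (h p)).comp (tangentMapAt h p)

/-- `ψ` is a smooth section over `U` of the family `W` of subspaces of `ℍ^{n+1}`. -/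
def IsSmoothSection (W : M → HSub n) (U : Set M) (ψ : M → HVec n) : Prop :=
  ContMDiffOn 𝓘(ℝ, ℂ) 𝓘(ℝ, HVec n) ∞ ψ U ∧ ∀ p ∈ U, ψ p ∈ W p

/-- `W` is a smooth quaternionic subbundle of rank `r` of the trivial `ℍ^{n+1}`-bundle:
it has smooth local frames. -/
def IsSmoothSubbundle (W : M → HSub n) (r : ℕ) : Prop :=
  ∀ p : M, ∃ U : Set M, IsOpen U ∧ p ∈ U ∧ ∃ e : Fin r → M → HVec n,
    (∀ i, IsSmoothSection W U (e i)) ∧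
    ∀ q ∈ U, LinearIndependent ℍ[ℝ]ᵐᵒᵖ (fun i => e i q) ∧
      Submodule.span ℍ[ℝ]ᵐᵒᵖ (Set.range fun i => e i q) = W q

/-- The derivative `δ_W = π_W ∇|_W` of a subbundle `W`, evaluated on a section `ψ` of `W`:
`secondFund W ψ p X = π_W (∇_X ψ)(p)` in `ℍ^{n+1} / W_p`.  It is tensorial in `ψ`, so that
identities for `δ_W` are identities for all local sections of `W`. -/
noncomputable def secondFund (W : M → HSub n) (ψ : M → HVec n) (p : M) (X : ℂ) :
    HVec n ⧸ W p :=
  (W p).mkQ (nabla ψ p X)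

/-- The derivative `δ_W` vanishes at `p`. -/
def DerivVanishesAt (W : M → HSub n) (p : M) : Prop :=
  ∀ (U : Set M) (ψ : M → HVec n), IsOpen U → p ∈ U → IsSmoothSection W U ψ →
    ∀ X : ℂ, secondFund W ψ p X = 0

/-- The covariant derivative of a section `S` of `End V`: `(∇_X S) v = ∇_X (S v)` for constant
`v`. -/
noncomputable def nablaEnd (S : M → HEnd n) (p : M) (X : ℂ) (v : HVec n) : HVec n :=
  nabla (fun q => S q v) p X

/-- The Hopf field `A = (1/4) (*∇S + S ∇S)`, that is, the `(1,0)`-part in the type decomposition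
`∇S = 2(*Q - *A)`, where `*A = S A` and `*Q = - S Q`. -/
noncomputable def hopfA (S : M → HEnd n) (p : M) (X : ℂ) (v : HVec n) : HVec n :=
  (1 / 4 : ℝ) • (nablaEnd S p (Complex.I * X) v + S p (nablaEnd S p X v))

end Calculus

section Curves

variable {M : Type*} [TopologicalSpace M] [ChartedSpace ℂ M] {n : ℕ}

/-- The line subbundle `L` of the trivial `ℍ^{n+1}`-bundle given by `f : M → ℍP^n`,
`L_p = f(p)`. -/
noncomputable def line (f : M → HP n) (p : M) : HSub n := (f p).submodule

/-- `f : M → ℍP^n` is a holomorphic curve: it is smooth and there is a smooth complex structure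
`J` on the quaternionic line bundle `L` with `*δ_L = δ_L J`.  (The endomorphism of `L_p` is given
as the restriction of `J p`; only this restriction enters.) -/
def IsHolomorphicCurve (f : M → HP n) : Prop :=
  IsSmoothSubbundle (line f) 1 ∧
  ∃ J : M → HEnd n,
    (∀ p, ∀ v ∈ line f p, J p v ∈ line f p ∧ J p (J p v) = -v) ∧
    ∀ (U : Set M) (ψ : M → HVec n), IsOpen U → IsSmoothSection (line f) U ψ →
      IsSmoothSection (line f) U (fun q => J q (ψ q)) ∧
      ∀ p ∈ U, ∀ X : ℂ,
        secondFund (line f) ψ p (Complex.I * X) =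
          secondFund (line f) (fun q => J q (ψ q)) p X

/-- `V 0 ⊂ V 1 ⊂ ⋯ ⊂ V n` is a smooth flag of quaternionic subbundles of the trivial
`ℍ^{n+1}`-bundle with `V 0 = L`, `rank (V k) = k + 1` (so that `V n` is the full bundle) and
`∇ Γ(V k) ⊂ Ω¹(V (k+1))`.  The values `V k` for `k > n` play no role. -/
structure IsOsculatingFlag (f : M → HP n) (V : ℕ → M → HSub n) : Prop where
  zero_eq : ∀ p, V 0 p = line f p
  smooth : ∀ k ≤ n, IsSmoothSubbundle (V k) (k + 1)
  le_succ : ∀ k < n, ∀ p, V k p ≤ V (k + 1) p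
  nabla_mem : ∀ k < n, ∀ (U : Set M) (ψ : M → HVec n), IsOpen U →
    IsSmoothSection (V k) U ψ → ∀ p ∈ U, ∀ X : ℂ, nabla ψ p X ∈ V (k + 1) p

/-- `S` is a smooth complex structure on the trivial `ℍ^{n+1}`-bundle that stabilizes the flag
`V` and satisfies `*δ_k = S δ_k = δ_k S` for the derivatives `δ_k` of the flag. -/
structure IsAdaptedComplexStructure (V : ℕ → M → HSub n) (S : M → HEnd n) : Prop where
  smooth : ∀ v, ContMDiff 𝓘(ℝ, ℂ) 𝓘(ℝ, HVec n) ∞ (fun p => S p v)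
  sq : ∀ p v, S p (S p v) = -v
  stable : ∀ k ≤ n, ∀ p, ∀ v ∈ V k p, S p v ∈ V k p
  star_eq_left : ∀ k < n, ∀ (U : Set M) (ψ : M → HVec n), IsOpen U →
    IsSmoothSection (V k) U ψ → ∀ p ∈ U, ∀ X : ℂ,
      secondFund (V k) ψ p (Complex.I * X) = (V k p).mkQ (S p (nabla ψ p X))
  star_eq_right : ∀ k < n, ∀ (U : Set M) (ψ : M → HVec n), IsOpen U →
    IsSmoothSection (V k) U ψ → ∀ p ∈ U, ∀ X : ℂ,
      secondFund (V k) ψ p (Complex.I * X) = secondFund (V k) (fun q => S q (ψ q)) p X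

/-- `p` is a Weierstrass point: one of the flag derivatives `δ_0, …, δ_{n-1}` vanishes at `p`. -/
def IsWeierstrassPoint (V : ℕ → M → HSub n) (p : M) : Prop :=
  ∃ k < n, DerivVanishesAt (V k) p

/-- The holomorphic curve `f : M → ℍP^n` is a Frenet curve with (smooth) Frenet flag `V` and
(smooth) canonical complex structure `S`: the Weierstrass points are isolated, and the adapted
complex structure `S` satisfies `A V ⊂ L`. -/
structure IsFrenetWith (f : M → HP n) (V : ℕ → M → HSub n) (S : M → HEnd n) : Prop where
  holomorphic : IsHolomorphicCurve f
  flag : IsOsculatingFlag f V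
  adapted : IsAdaptedComplexStructure V S
  weierstrass_discrete : ∀ p : M, ∀ᶠ q in 𝓝[≠] p, ¬ IsWeierstrassPoint V q
  canonical : ∀ (p : M) (X : ℂ) (v : HVec n), hopfA S p X v ∈ line f p

/-- `η ∈ H⁰(KL)`, where `L` carries the complex structure `S|_L`: `η` is a smooth closed 1-form
with values in `L` and `*η = S η`.  Smoothness and closedness (symmetry of the derivative of the
coefficients) are expressed in the charts of `M`. -/
structure IsHolomorphicForm (f : M → HP n) (S : M → HEnd n)
    (η : M → (ℂ →L[ℝ] HVec n)) : Prop where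
  mem_line : ∀ p X, η p X ∈ line f p
  star_eq : ∀ p X, η p (Complex.I * X) = S p (η p X)
  smooth : ∀ c : M, ContDiffOn ℝ ∞ (pullbackForm (chartAt ℂ c).symm η) (chartAt ℂ c).target
  closed : ∀ c : M, ∀ z ∈ (chartAt ℂ c).target, ∀ X Y : ℂ,
    fderiv ℝ (pullbackForm (chartAt ℂ c).symm η) z X Y =
      fderiv ℝ (pullbackForm (chartAt ℂ c).symm η) z Y X

/-- `ft : M → ℍP^n` is the tangent curve of the Frenet curve `f : M → ℍP^{n+1}` with respect to
the hyperplane `H = ℍ^{n+1} ⊂ ℍ^{n+2}`: `f` does not meet `H`, and `ft = V_1 ∩ H`. -/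
def IsTangentCurve (f : M → HP (n + 1)) (ft : M → HP n) : Prop :=
  ∃ (V : ℕ → M → HSub (n + 1)) (S : M → HEnd (n + 1)), IsFrenetWith f V S ∧
    ∀ p, line f p ⊓ (hyperplaneIncl n).range = ⊥ ∧
      V 1 p ⊓ (hyperplaneIncl n).range = (line ft p).map (hyperplaneIncl n)

end Curves

/-! ### Curves with monodromy -/

section Monodromy

variable {M C : Type*} [TopologicalSpace M] [TopologicalSpace C] {n : ℕ}

/-- The group of deck transformations of `π : C → M`. -/
def deckGroup (π : C → M) : Subgroup (C ≃ₜ C) where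
  carrier := {γ | ∀ x, π (γ x) = π x}
  mul_mem' {a b} ha hb x := (ha (b x)).trans (hb x)
  one_mem' _ := rfl
  inv_mem' {a} ha x := by
    have h := ha (a⁻¹ x)
    have e : a (a⁻¹ x) = x := a.apply_symm_apply x
    rw [e] at h
    exact h.symm

/-- `f : C → ℍP^n`, defined on the universal covering `π : C → M`, is a map on `M` with
monodromy: it is equivariant with respect to a representation of the group of deck
transformations by quaternionic linear automorphisms of `ℍ^{n+1}`. -/
def HasMonodromy (π : C → M) (f : C → HP n) : Prop :=
  ∃ ρ : deckGroup π →* (HVec n ≃ₗ[ℍ[ℝ]ᵐᵒᵖ] HVec n),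
    ∀ (γ : deckGroup π) (x : C),
      (f ((γ : C ≃ₜ C) x)).submodule = (f x).submodule.map (ρ γ : HVec n →ₗ[ℍ[ℝ]ᵐᵒᵖ] HVec n)

end Monodromy

/-- `C` with `π : C → M` is the universal covering of the Riemann surface `M` (the complex
structure of `C` being the lifted one). -/
structure IsUniversalCovering {C M : Type*} [TopologicalSpace C] [ChartedSpace ℂ C]
    [TopologicalSpace M] [ChartedSpace ℂ M] (π : C → M) : Prop where
  simplyConnected : SimplyConnectedSpace C
  covering : IsCoveringMap π
  localBiholomorphism : IsLocalDiffeomorph 𝓘(ℂ) 𝓘(ℂ) ω π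

end FrenetCurves

/-!
# The curve with a prescribed tangent curve

Let `g` be a primitive of `π^* η` on the universal covering and let `f = [g : 1]`, with line bundle
`L` spanned by `(g, 1)`.  The projection `projAlong g` of `ℍ^{m+2}` onto the hyperplane `ℍ^{m+1}`
along `(g, 1)` identifies the trivial bundle modulo `L` with the trivial `ℍ^{m+1}`-bundle, and it
commutes with `∇` up to the term `dg` (`projAlong_nabla`), which takes values in the line bundle
of the given curve.  Hence the preimages of the flag `V` of the given curve, with `L` put in
front, are an osculating flag of `f`; its first derivative is `dg`, which vanishes nowhere, and the
others are those of `V`, so there are no new Weierstrass points.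

In the decomposition `ℍ^{m+2} = ℍ^{m+1} ⊕ L` the canonical complex structure of `f` has the form
`(S, 0; B, N)`.  The condition `*δ_0 = S δ_0 = δ_0 N` determines `N` by `S dg = dg N`
(`rightNormal`).  Modulo `L`, the Hopf field of the lifted structure is `A + ½ *dg B`, with `A` the
Hopf field of `S`.  Since `A` takes values in the line spanned by `*dg`, and both are of type
`(1,0)`, the equation `*dg B = -2 A` has a unique solution `B` (`offDiag`), which makes the Hopf
field of the lift `L`-valued (`IsAffineLift.hopfA_liftStructure_mem`).  As `A` anticommutes with
`S`, one has `B S + N B = 0`, so that the lifted structure has square `-1`.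

The primitive exists because the germs of the local primitives given by the Poincaré lemma form a
covering of the simply connected surface, which has a global section
(`exists_global_of_locally_const_differences`).  Under a deck transformation `g` changes by a
constant, so that `f` changes by a translation of the affine chart, which is a quaternionic linear
automorphism of `ℍ^{m+2}`.
-/

namespace FrenetCurves

/-! ### The real structure of a Riemann surface -/

section RealStructure

variable {M : Type*} [TopologicalSpace M] [ChartedSpace ℂ M]
  {N : Type*} [TopologicalSpace N] [ChartedSpace ℂ N] {n : ℕ}

theorem isManifold_real [IsManifold 𝓘(ℂ) ω M] : IsManifold 𝓘(ℝ, ℂ) ∞ M := by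
  refine isManifold_of_contDiffOn 𝓘(ℝ, ℂ) ∞ M fun e e' he he' => ?_
  have h := (contDiffGroupoid ω 𝓘(ℂ)).compatible (M := M) he he'
  have h1 := (contDiffGroupoid_le (I := 𝓘(ℂ)) (m := ∞) (n := ω) le_top h).1
  simpa [contDiffPregroupoid] using ContDiffOn.restrict_scalars ℝ h1

theorem contMDiffOn_real {h : N → M} {s : Set N}
    (hh : ContMDiffOn 𝓘(ℂ) 𝓘(ℂ) ω h s) : ContMDiffOn 𝓘(ℝ, ℂ) 𝓘(ℝ, ℂ) ∞ h s := by
  intro x hx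
  have := (hh x hx).of_le (m := ∞) le_top
  rw [contMDiffWithinAt_iff] at this ⊢
  exact ⟨this.1, this.2.restrict_scalars ℝ⟩

theorem tangentMapAt_eq_restrictScalars {h : N → M} {x : N}
    (hh : MDifferentiableAt 𝓘(ℂ) 𝓘(ℂ) h x) :
    ∃ D : ℂ →L[ℂ] ℂ, tangentMapAt h x = D.restrictScalars ℝ := by
  have h1 := hh.hasMFDerivAt
  let D : ℂ →L[ℂ] ℂ := mfderiv 𝓘(ℂ) 𝓘(ℂ) h x
  have h2 := HasFDerivWithinAt.restrictScalars ℝ (f' := D) h1.2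
  exact ⟨D, HasMFDerivAt.mfderiv (I := 𝓘(ℝ, ℂ)) (I' := 𝓘(ℝ, ℂ)) ⟨h1.1, h2⟩⟩

theorem tangentMapAt_I_mul {h : N → M} {x : N}
    (hh : MDifferentiableAt 𝓘(ℂ) 𝓘(ℂ) h x) (X : ℂ) :
    tangentMapAt h x (Complex.I * X) = Complex.I * tangentMapAt h x X := by
  obtain ⟨D, hD⟩ := tangentMapAt_eq_restrictScalars hh
  rw [hD]
  exact map_smul D Complex.I X

theorem nabla_comp {ψ : M → HVec n} {h : N → M} {x : N}
    (hψ : MDifferentiableAt 𝓘(ℝ, ℂ) 𝓘(ℝ, HVec n) ψ (h x))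
    (hh : MDifferentiableAt 𝓘(ℝ, ℂ) 𝓘(ℝ, ℂ) h x) :
    nabla (ψ ∘ h) x = (nabla ψ (h x)).comp (tangentMapAt h x) :=
  mfderiv_comp x hψ hh

theorem nabla_congr {ψ φ : M → HVec n} {x : M} (h : ψ =ᶠ[𝓝 x] φ) : nabla ψ x = nabla φ x :=
  h.mfderiv_eq

theorem tangentMapAt_comp {P : Type*} [TopologicalSpace P] [ChartedSpace ℂ P]
    {k : M → P} {h : N → M} {x : N}
    (hk : MDifferentiableAt 𝓘(ℝ, ℂ) 𝓘(ℝ, ℂ) k (h x))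
    (hh : MDifferentiableAt 𝓘(ℝ, ℂ) 𝓘(ℝ, ℂ) h x) :
    tangentMapAt (k ∘ h) x = (tangentMapAt k (h x)).comp (tangentMapAt h x) :=
  mfderiv_comp x hk hh

theorem tangentMapAt_id (x : M) : tangentMapAt (id : M → M) x = ContinuousLinearMap.id ℝ ℂ :=
  mfderiv_id

theorem tangentMapAt_congr {k h : N → M} {x : N} (e : k =ᶠ[𝓝 x] h) :
    tangentMapAt k x = tangentMapAt h x := e.mfderiv_eq

/-- If `k` is a local left inverse of `h`, then the tangent map of `k` inverts that of `h`. -/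
theorem tangentMapAt_leftInverse {k : M → N} {h : N → M} {x : N}
    (hk : MDifferentiableAt 𝓘(ℝ, ℂ) 𝓘(ℝ, ℂ) k (h x))
    (hh : MDifferentiableAt 𝓘(ℝ, ℂ) 𝓘(ℝ, ℂ) h x) (e : ∀ᶠ y in 𝓝 x, k (h y) = y) (X : ℂ) :
    tangentMapAt k (h x) (tangentMapAt h x X) = X := by
  have h1 := tangentMapAt_comp hk hh
  have h2 : tangentMapAt (k ∘ h) x = tangentMapAt id x := tangentMapAt_congr e
  rw [h2, tangentMapAt_id] at h1
  simpa using (DFunLike.congr_fun h1 X).symm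

variable [IsManifold 𝓘(ℂ) ω M]

/-- The coordinate field `∂/∂x` of the preferred chart at `p`. -/
noncomputable def coordField (p q : M) : ℂ :=
  tangentMapAt (N := ℂ) (chartAt ℂ p).symm (chartAt ℂ p q) 1

theorem mdifferentiableAt_chart_symm_complex {p : M} {z : ℂ} (hz : z ∈ (chartAt ℂ p).target) :
    MDifferentiableAt 𝓘(ℂ) 𝓘(ℂ) (chartAt ℂ p).symm z :=
  ((contMDiffOn_chart_symm (I := 𝓘(ℂ)) (n := ω)).contMDiffAt
    ((chartAt ℂ p).open_target.mem_nhds hz)).mdifferentiableAt (by simp)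

theorem mdifferentiableAt_chart_symm_real {p : M} {z : ℂ} (hz : z ∈ (chartAt ℂ p).target) :
    MDifferentiableAt 𝓘(ℝ, ℂ) 𝓘(ℝ, ℂ) (chartAt ℂ p).symm z :=
  have : IsManifold 𝓘(ℝ, ℂ) ∞ M := isManifold_real
  ((contMDiffOn_chart_symm (I := 𝓘(ℝ, ℂ)) (n := ∞)).contMDiffAt
    ((chartAt ℂ p).open_target.mem_nhds hz)).mdifferentiableAt (by simp)

theorem mdifferentiableAt_chart_real {p q : M} (hq : q ∈ (chartAt ℂ p).source) :
    MDifferentiableAt 𝓘(ℝ, ℂ) 𝓘(ℝ, ℂ) (chartAt ℂ p) q :=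
  have : IsManifold 𝓘(ℝ, ℂ) ∞ M := isManifold_real
  ((contMDiffOn_chart (I := 𝓘(ℝ, ℂ)) (n := ∞)).contMDiffAt
    ((chartAt ℂ p).open_source.mem_nhds hq)).mdifferentiableAt (by simp)

theorem coordField_ne_zero {p q : M} (hq : q ∈ (chartAt ℂ p).source) : coordField p q ≠ 0 := by
  intro h0
  have hz := (chartAt ℂ p).map_source hq
  have e : ∀ᶠ w in 𝓝 (chartAt ℂ p q), chartAt ℂ p ((chartAt ℂ p).symm w) = w := by
    filter_upwards [(chartAt ℂ p).open_target.mem_nhds hz] with w hw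
    exact (chartAt ℂ p).right_inv hw
  have hk : MDifferentiableAt 𝓘(ℝ, ℂ) 𝓘(ℝ, ℂ) (chartAt ℂ p)
      ((chartAt ℂ p).symm (chartAt ℂ p q)) := by
    rw [(chartAt ℂ p).left_inv hq]; exact mdifferentiableAt_chart_real hq
  have := tangentMapAt_leftInverse hk (mdifferentiableAt_chart_symm_real hz) e 1
  rw [coordField] at h0
  rw [h0] at this
  simp at this

theorem nabla_mul_coordField {p q : M} (hq : q ∈ (chartAt ℂ p).source) {ψ : M → HVec n}
    (hψ : MDifferentiableAt 𝓘(ℝ, ℂ) 𝓘(ℝ, HVec n) ψ q) :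
    nabla ψ q (coordField p q) = fderiv ℝ (ψ ∘ (chartAt ℂ p).symm) (chartAt ℂ p q) 1 ∧
    nabla ψ q (Complex.I * coordField p q) =
      fderiv ℝ (ψ ∘ (chartAt ℂ p).symm) (chartAt ℂ p q) Complex.I := by
  have hz := (chartAt ℂ p).map_source hq
  have hl := (chartAt ℂ p).left_inv hq
  have h1 := nabla_comp (N := ℂ) (h := (chartAt ℂ p).symm) (x := chartAt ℂ p q) (ψ := ψ)
    (by rw [hl]; exact hψ) (mdifferentiableAt_chart_symm_real hz)
  have h2 : nabla (ψ ∘ (chartAt ℂ p).symm) (chartAt ℂ p q)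
    = fderiv ℝ (ψ ∘ (chartAt ℂ p).symm) (chartAt ℂ p q) := mfderiv_eq_fderiv
  rw [hl] at h1
  rw [← h2, h1]
  refine ⟨rfl, ?_⟩
  rw [coordField, ← tangentMapAt_I_mul (mdifferentiableAt_chart_symm_complex hz)]
  simp

/-- The derivatives of a smooth function along the coordinate fields of a chart are smooth. -/
theorem contMDiffOn_nabla_coordField (p : M) {ψ : M → HVec n}
    (hψ : ContMDiff 𝓘(ℝ, ℂ) 𝓘(ℝ, HVec n) ∞ ψ) :
    ContMDiffOn 𝓘(ℝ, ℂ) 𝓘(ℝ, HVec n) ∞ (fun q => nabla ψ q (coordField p q))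
      (chartAt ℂ p).source ∧
    ContMDiffOn 𝓘(ℝ, ℂ) 𝓘(ℝ, HVec n) ∞ (fun q => nabla ψ q (Complex.I * coordField p q))
      (chartAt ℂ p).source := by
  have : IsManifold 𝓘(ℝ, ℂ) ∞ M := isManifold_real
  have hc : ContDiffOn ℝ ∞ (ψ ∘ (chartAt ℂ p).symm) (chartAt ℂ p).target :=
    (hψ.comp_contMDiffOn (contMDiffOn_chart_symm (I := 𝓘(ℝ, ℂ)) (n := ∞))).contDiffOn
  have hd : ContDiffOn ℝ ∞ (fderiv ℝ (ψ ∘ (chartAt ℂ p).symm)) (chartAt ℂ p).target :=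
    hc.fderiv_of_isOpen (chartAt ℂ p).open_target (by simp)
  have key : ∀ X : ℂ, ContMDiffOn 𝓘(ℝ, ℂ) 𝓘(ℝ, HVec n) ∞
      (fun q => fderiv ℝ (ψ ∘ (chartAt ℂ p).symm) (chartAt ℂ p q) X) (chartAt ℂ p).source :=
    fun X => (hd.clm_apply contDiffOn_const).contMDiffOn.comp
      (contMDiffOn_chart (I := 𝓘(ℝ, ℂ)) (n := ∞)) fun q hq => (chartAt ℂ p).map_source hq
  exact ⟨(key 1).congr fun q hq => (nabla_mul_coordField hq (hψ.mdifferentiable (by simp) q)).1,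
    (key _).congr fun q hq => (nabla_mul_coordField hq (hψ.mdifferentiable (by simp) q)).2⟩

end RealStructure

/-! ### Primitives of closed forms on simply connected surfaces -/

/-- On a simply connected space, local functions whose differences are locally constant can be
corrected by local constants to a global function.  The germs of corrected functions form a
fibre bundle with discrete fibre, that is, a covering, and the identity lifts to it. -/
theorem exists_global_of_locally_const_differences {X E : Type*} [TopologicalSpace X]
    [SimplyConnectedSpace X] [LocallyPathConnectedSpace X] [AddCommGroup E]
    (U : X → Set X) (hU : ∀ i, IsOpen (U i)) (hmem : ∀ x, x ∈ U x) (h : X → X → E)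
    (hh : ∀ i j, ∀ x ∈ U i ∩ U j, ∀ᶠ y in 𝓝 x, h i y - h j y = h i x - h j x) :
    ∃ g : X → E, ∀ x i, x ∈ U i → ∀ᶠ y in 𝓝 x, g y - h i y = g x - h i x := by
  let _ : TopologicalSpace E := ⊥
  have : DiscreteTopology E := ⟨rfl⟩
  -- the coordinate over `U i` of the germ with value `a` at `x` is `a - h i x`
  let Z : FiberBundleCore X X E :=
    { baseSet := U
      isOpen_baseSet := hU
      indexAt := id
      mem_baseSet_at := hmem
      coordChange := fun i j x v => v + (h i x - h j x)
      coordChange_self := fun i x _ v => by simp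
      continuousOn_coordChange := fun i j => by
        rintro ⟨x, v⟩ ⟨hx, -⟩
        refine ContinuousAt.continuousWithinAt ?_
        have h1 : ∀ᶠ q : X × E in 𝓝 (x, v), q.2 = v := by
          have : ContinuousAt (fun q : X × E => q.2) (x, v) := continuousAt_snd
          exact this.preimage_mem_nhds ((isOpen_discrete {v}).mem_nhds rfl)
        have h2 : ∀ᶠ q : X × E in 𝓝 (x, v), h i q.1 - h j q.1 = h i x - h j x := by
          have : ContinuousAt (fun q : X × E => q.1) (x, v) := continuousAt_fst
          exact this.eventually (hh i j x hx)
        refine continuousAt_const (y := v + (h i x - h j x)) |>.congr ?_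
        filter_upwards [h1, h2] with q e1 e2
        rw [e1, e2]
      coordChange_comp := fun i j k x _ v => by abel }
  have cov : IsCoveringMap Z.proj := FiberBundle.isCoveringMap (F := E) (E := Z.Fiber)
  obtain ⟨x₀⟩ : Nonempty X := inferInstance
  obtain ⟨s, ⟨-, hs⟩, -⟩ := cov.existsUnique_continuousMap_lifts (ContinuousMap.id X) x₀
    (⟨x₀, (0 : E)⟩ : Z.TotalSpace) rfl
  have hs1 : ∀ x, (s x).1 = x := fun x => congrFun hs x
  refine ⟨fun x => (show E from (s x).2) + h x x, fun x i hx => ?_⟩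
  have hval : ∀ y, (Z.localTriv i (s y)).2 = ((show E from (s y).2) + h y y) - h i y := by
    intro y
    have : (Z.localTriv i (s y)).2 = (show E from (s y).2) + (h (s y).1 (s y).1 - h i (s y).1) :=
      rfl
    rw [this, hs1 y]
    abel
  have hcont : ContinuousAt (fun y => (Z.localTriv i (s y)).2) x := by
    refine continuousAt_snd.comp (((Z.localTriv i).continuousAt ?_).comp s.continuous.continuousAt)
    rw [(Z.localTriv i).mem_source]
    change (s x).1 ∈ U i
    rw [hs1 x]
    exact hx
  have hev : ∀ᶠ y in 𝓝 x, (Z.localTriv i (s y)).2 = (Z.localTriv i (s x)).2 :=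
    hcont.preimage_mem_nhds ((isOpen_discrete {_}).mem_nhds rfl)
  filter_upwards [hev] with y hy
  rw [← hval, ← hval, hy]

section

variable {M : Type*} [TopologicalSpace M] [ChartedSpace ℂ M] [IsManifold 𝓘(ℂ) ω M]
  {C : Type*} [TopologicalSpace C] [ChartedSpace ℂ C] {n : ℕ}

theorem eventually_eq_of_nabla_eq_zero {ψ : M → HVec n} {x : M}
    (h : ∀ᶠ y in 𝓝 x, MDifferentiableAt 𝓘(ℝ, ℂ) 𝓘(ℝ, HVec n) ψ y ∧ nabla ψ y = 0) :
    ∀ᶠ y in 𝓝 x, ψ y = ψ x := by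
  set c := chartAt ℂ x
  have hx : x ∈ c.source := mem_chart_source ℂ x
  have hz : c x ∈ c.target := c.map_source hx
  have h1 : ∀ᶠ z in 𝓝 (c x), z ∈ c.target ∧
      (MDifferentiableAt 𝓘(ℝ, ℂ) 𝓘(ℝ, HVec n) ψ (c.symm z) ∧ nabla ψ (c.symm z) = 0) := by
    refine Filter.Eventually.and (c.open_target.mem_nhds hz) ?_
    have := c.continuousAt_symm hz
    rw [ContinuousAt, c.left_inv hx] at this
    exact this.eventually h
  obtain ⟨r, hr, hball⟩ := Metric.eventually_nhds_iff_ball.1 h1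
  have hder : ∀ z ∈ Metric.ball (c x) r, HasFDerivAt (ψ ∘ c.symm) (0 : ℂ →L[ℝ] HVec n) z := by
    intro z hzr
    obtain ⟨hzt, hd, h0⟩ := hball z hzr
    have e := nabla_comp hd (mdifferentiableAt_chart_symm_real hzt)
    rw [h0, ContinuousLinearMap.zero_comp] at e
    rw [← e]
    exact (hd.comp z (mdifferentiableAt_chart_symm_real hzt)).hasMFDerivAt.hasFDerivAt
  filter_upwards [(c.continuousAt hx).eventually (Metric.ball_mem_nhds _ hr),
    c.open_source.mem_nhds hx] with y hy hys
  have := Metric.isOpen_ball.is_const_of_fderiv_eq_zero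
    (convex_ball (c x) r).isPreconnected
    (fun z hz => (hder z hz).differentiableAt.differentiableWithinAt)
    (fun z hz => (hder z hz).fderiv) hy (Metric.mem_ball_self hr)
  simpa [c.left_inv hys, c.left_inv hx] using this

omit [IsManifold 𝓘(ℂ) ω M] in
theorem nabla_sub {ψ φ : M → HVec n} {x : M}
    (hψ : MDifferentiableAt 𝓘(ℝ, ℂ) 𝓘(ℝ, HVec n) ψ x)
    (hφ : MDifferentiableAt 𝓘(ℝ, ℂ) 𝓘(ℝ, HVec n) φ x) :
    nabla (fun y => ψ y - φ y) x = nabla ψ x - nabla φ x :=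
  (hψ.hasMFDerivAt.sub hφ.hasMFDerivAt).mfderiv

theorem eventually_sub_eq_of_nabla_eq {ψ φ : M → HVec n} {x : M}
    (hψ : ∀ᶠ y in 𝓝 x, MDifferentiableAt 𝓘(ℝ, ℂ) 𝓘(ℝ, HVec n) ψ y)
    (hφ : ∀ᶠ y in 𝓝 x, MDifferentiableAt 𝓘(ℝ, ℂ) 𝓘(ℝ, HVec n) φ y)
    (h : ∀ᶠ y in 𝓝 x, nabla ψ y = nabla φ y) :
    ∀ᶠ y in 𝓝 x, ψ y - φ y = ψ x - φ x := by
  refine eventually_eq_of_nabla_eq_zero (ψ := fun y => ψ y - φ y) ?_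
  filter_upwards [hψ, hφ, h] with y h1 h2 h3
  exact ⟨h1.sub h2, by rw [nabla_sub h1 h2, h3, sub_self]⟩

theorem exists_sub_eq_const_of_nabla_eq [ConnectedSpace M] {ψ φ : M → HVec n}
    (hψ : MDifferentiable 𝓘(ℝ, ℂ) 𝓘(ℝ, HVec n) ψ) (hφ : MDifferentiable 𝓘(ℝ, ℂ) 𝓘(ℝ, HVec n) φ)
    (h : nabla ψ = nabla φ) : ∃ c, ∀ x, ψ x = φ x + c := by
  have hl : IsLocallyConstant fun y => ψ y - φ y :=
    (IsLocallyConstant.iff_eventually_eq _).2 fun x =>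
      eventually_sub_eq_of_nabla_eq (.of_forall hψ) (.of_forall hφ) (.of_forall (congrFun h))
  obtain ⟨x₀⟩ : Nonempty M := inferInstance
  refine ⟨ψ x₀ - φ x₀, fun x => ?_⟩
  have := hl.apply_eq_of_preconnectedSpace x x₀
  rw [← this]
  abel

/-- `θ` has smooth primitives locally. -/
def HasLocalPrimitives (θ : M → (ℂ →L[ℝ] HVec n)) : Prop :=
  ∀ x : M, ∃ U : Set M, IsOpen U ∧ x ∈ U ∧ ∃ h : M → HVec n,
    ContMDiffOn 𝓘(ℝ, ℂ) 𝓘(ℝ, HVec n) ∞ h U ∧ ∀ y ∈ U, nabla h y = θ y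

omit [IsManifold 𝓘(ℂ) ω M] in
theorem mdifferentiableAt_of_contMDiffOn {ψ : M → HVec n} {U : Set M} (hU : IsOpen U)
    (h : ContMDiffOn 𝓘(ℝ, ℂ) 𝓘(ℝ, HVec n) ∞ ψ U) {y : M} (hy : y ∈ U) :
    MDifferentiableAt 𝓘(ℝ, ℂ) 𝓘(ℝ, HVec n) ψ y :=
  (h.contMDiffAt (hU.mem_nhds hy)).mdifferentiableAt (by simp)

theorem HasLocalPrimitives.exists_primitive [SimplyConnectedSpace M]
    {θ : M → (ℂ →L[ℝ] HVec n)} (hθ : HasLocalPrimitives θ) :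
    ∃ g : M → HVec n, ContMDiff 𝓘(ℝ, ℂ) 𝓘(ℝ, HVec n) ∞ g ∧ nabla g = θ := by
  choose U hU hx h hs hd using hθ
  have : LocallyPathConnectedSpace M := ChartedSpace.locallyPathConnectedSpace ℂ M
  obtain ⟨g, hg⟩ := exists_global_of_locally_const_differences U hU hx h (by
    rintro i j x ⟨hi, hj⟩
    refine eventually_sub_eq_of_nabla_eq ?_ ?_ ?_
    · filter_upwards [(hU i).mem_nhds hi] with y hy
      exact mdifferentiableAt_of_contMDiffOn (hU i) (hs i) hy
    · filter_upwards [(hU j).mem_nhds hj] with y hy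
      exact mdifferentiableAt_of_contMDiffOn (hU j) (hs j) hy
    · filter_upwards [(hU i).mem_nhds hi, (hU j).mem_nhds hj] with y hy hy'
      rw [hd i y hy, hd j y hy'])
  have hev : ∀ x, g =ᶠ[𝓝 x] fun y => h x y - (h x x - g x) := fun x => by
    filter_upwards [hg x x (hx x)] with y hy
    rw [sub_eq_iff_eq_add] at hy
    rw [hy]
    abel
  have hsm : ∀ x, ContMDiffAt 𝓘(ℝ, ℂ) 𝓘(ℝ, HVec n) ∞ (h x) x := fun x =>
    (hs x).contMDiffAt ((hU x).mem_nhds (hx x))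
  refine ⟨g, fun x => ?_, funext fun x => ?_⟩
  · exact ((hsm x).sub contMDiffAt_const).congr_of_eventuallyEq (hev x)
  · rw [nabla_congr (hev x), nabla_sub ((hsm x).mdifferentiableAt (by simp))
      mdifferentiableAt_const, hd x x (hx x)]
    have : nabla (fun _ : M => h x x - g x) x = 0 := mfderiv_const
    rw [this, sub_zero]

/-- The Poincaré lemma in the charts of a surface. -/
theorem hasLocalPrimitives_of_closed {θ : M → (ℂ →L[ℝ] HVec n)}
    (smooth : ∀ c : M,
      ContDiffOn ℝ ∞ (pullbackForm (chartAt ℂ c).symm θ) (chartAt ℂ c).target)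
    (closed : ∀ c : M, ∀ z ∈ (chartAt ℂ c).target, ∀ X Y : ℂ,
      fderiv ℝ (pullbackForm (chartAt ℂ c).symm θ) z X Y =
        fderiv ℝ (pullbackForm (chartAt ℂ c).symm θ) z Y X) :
    HasLocalPrimitives θ := by
  intro x
  have : IsManifold 𝓘(ℝ, ℂ) ∞ M := isManifold_real
  have smooth := smooth x
  have closed := closed x
  set c := chartAt ℂ x
  have hx : x ∈ c.source := mem_chart_source ℂ x
  have hz : c x ∈ c.target := c.map_source hx
  obtain ⟨r, hr, hball⟩ := Metric.isOpen_iff.1 c.open_target _ hz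
  obtain ⟨k, hk⟩ := (convex_ball (c x) r).exists_forall_hasFDerivAt_of_fderiv_symmetric
    Metric.isOpen_ball ((smooth.mono hball).differentiableOn (by simp))
    fun a ha => closed a (hball ha)
  have hks : ContDiffOn ℝ ∞ k (Metric.ball (c x) r) := by
    rw [contDiffOn_infty_iff_fderiv_of_isOpen Metric.isOpen_ball]
    exact ⟨fun z hz => (hk z hz).differentiableAt.differentiableWithinAt,
      (smooth.mono hball).congr fun z hz => (hk z hz).fderiv⟩
  refine ⟨c.source ∩ c ⁻¹' Metric.ball (c x) r,
    c.isOpen_inter_preimage Metric.isOpen_ball, ⟨hx, Metric.mem_ball_self hr⟩, k ∘ c, ?_, ?_⟩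
  · exact hks.contMDiffOn.comp
      ((contMDiffOn_chart (I := 𝓘(ℝ, ℂ)) (n := ∞)).mono Set.inter_subset_left)
      fun y hy => hy.2
  · rintro y ⟨hys, hyb⟩
    have h1 : MDifferentiableAt 𝓘(ℝ, ℂ) 𝓘(ℝ, HVec n) k (c y) :=
      (hk _ hyb).differentiableAt.mdifferentiableAt
    rw [nabla_comp h1 (mdifferentiableAt_chart_real hys)]
    have h2 : nabla k (c y) = pullbackForm c.symm θ (c y) :=
      mfderiv_eq_fderiv.trans (hk _ hyb).fderiv
    rw [h2]
    ext1 X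
    have e : ∀ᶠ w in 𝓝 y, c.symm (c w) = w := by
      filter_upwards [c.open_source.mem_nhds hys] with w hw
      exact c.left_inv hw
    have h3 := tangentMapAt_leftInverse (mdifferentiableAt_chart_symm_real (c.map_source hys))
      (mdifferentiableAt_chart_real hys) e X
    simp only [pullbackForm, ContinuousLinearMap.comp_apply]
    rw [h3, c.left_inv hys]

omit [IsManifold 𝓘(ℂ) ω M] in
theorem HasLocalPrimitives.pullback {θ : M → (ℂ →L[ℝ] HVec n)} (hθ : HasLocalPrimitives θ)
    {π : C → M} (hπ : ContMDiff 𝓘(ℝ, ℂ) 𝓘(ℝ, ℂ) ∞ π) :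
    HasLocalPrimitives (pullbackForm π θ) := by
  intro x
  obtain ⟨U, hU, hx, h, hs, hd⟩ := hθ (π x)
  refine ⟨π ⁻¹' U, hU.preimage hπ.continuous, hx, h ∘ π,
    hs.comp hπ.contMDiffOn fun y hy => hy, fun y hy => ?_⟩
  rw [nabla_comp (mdifferentiableAt_of_contMDiffOn hU hs hy) (hπ.mdifferentiable (by simp) y),
    hd _ hy]
  rfl

end

/-! ### Differentiating families of linear maps -/

section Families

variable {M : Type*} [TopologicalSpace M] [ChartedSpace ℂ M] {n : ℕ}

theorem hasFDerivAt_nabla {ψ : M → HVec n} {p : M}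
    (h : MDifferentiableAt 𝓘(ℝ, ℂ) 𝓘(ℝ, HVec n) ψ p) :
    HasFDerivAt (ψ ∘ (chartAt ℂ p).symm) (nabla ψ p) (chartAt ℂ p p) := by
  have h2 : HasFDerivWithinAt (ψ ∘ (chartAt ℂ p).symm) (nabla ψ p) (Set.range (id : ℂ → ℂ))
    (chartAt ℂ p p) := h.hasMFDerivAt.2
  rwa [Set.range_id, hasFDerivWithinAt_univ] at h2

theorem nabla_eq_of_hasFDerivAt {ψ : M → HVec n} {p : M} {D : ℂ →L[ℝ] HVec n}
    (hc : ContinuousAt ψ p)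
    (h : HasFDerivAt (ψ ∘ (chartAt ℂ p).symm) D (chartAt ℂ p p)) : nabla ψ p = D := by
  refine HasMFDerivAt.mfderiv (I := 𝓘(ℝ, ℂ)) (I' := 𝓘(ℝ, HVec n)) ⟨hc, ?_⟩
  rw [← hasFDerivWithinAt_univ, ← Set.range_id] at h
  exact h

variable {E F : Type*} [NormedAddCommGroup E] [NormedSpace ℝ E] [FiniteDimensional ℝ E]
  [NormedAddCommGroup F] [NormedSpace ℝ F]

theorem linearMap_apply_eq_sum (T : E →ₗ[ℝ] F) (v : E) :
    T v = ∑ i, (Module.finBasis ℝ E).coord i v • T (Module.finBasis ℝ E i) := by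
  conv_lhs => rw [← (Module.finBasis ℝ E).sum_repr v, map_sum]
  simp only [map_smul, Module.Basis.coord_apply]

theorem contMDiffOn_linearMap_apply {T : M → E →ₗ[ℝ] F} {ψ : M → E} {U : Set M}
    (hT : ∀ v, ContMDiffOn 𝓘(ℝ, ℂ) 𝓘(ℝ, F) ∞ (fun p => T p v) U)
    (hψ : ContMDiffOn 𝓘(ℝ, ℂ) 𝓘(ℝ, E) ∞ ψ U) :
    ContMDiffOn 𝓘(ℝ, ℂ) 𝓘(ℝ, F) ∞ (fun p => T p (ψ p)) U := by
  have e : (fun p => T p (ψ p)) = fun p =>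
      ∑ i, (Module.finBasis ℝ E).coord i (ψ p) • T p (Module.finBasis ℝ E i) :=
    funext fun p => linearMap_apply_eq_sum _ _
  rw [e]
  refine contMDiffOn_finsetSum fun i _ => ?_
  have hc : ContMDiffOn 𝓘(ℝ, ℂ) 𝓘(ℝ, ℝ) ∞ (fun p => (Module.finBasis ℝ E).coord i (ψ p)) U :=
    (LinearMap.toContinuousLinearMap
      ((Module.finBasis ℝ E).coord i)).contDiff.contMDiff.comp_contMDiffOn hψ
  exact hc.smul (hT _)

theorem contMDiffOn_end_apply {S : M → HEnd n} {ψ : M → HVec n} {U : Set M}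
    (hS : ∀ v, ContMDiff 𝓘(ℝ, ℂ) 𝓘(ℝ, HVec n) ∞ (fun p => S p v))
    (hψ : ContMDiffOn 𝓘(ℝ, ℂ) 𝓘(ℝ, HVec n) ∞ ψ U) :
    ContMDiffOn 𝓘(ℝ, ℂ) 𝓘(ℝ, HVec n) ∞ (fun p => S p (ψ p)) U :=
  contMDiffOn_linearMap_apply (T := fun p => (S p).restrictScalars ℝ)
    (fun v => (hS v).contMDiffOn) hψ

/-- The product rule `∇ (T ψ) = (∇ T) ψ + T ∇ ψ` for a family `T` of linear maps. -/
theorem nabla_linearMap_apply {k : ℕ} {T : M → HVec k →ₗ[ℝ] HVec n} {ψ : M → HVec k} {p : M}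
    (hT : ∀ v, MDifferentiableAt 𝓘(ℝ, ℂ) 𝓘(ℝ, HVec n) (fun p => T p v) p)
    (hψ : MDifferentiableAt 𝓘(ℝ, ℂ) 𝓘(ℝ, HVec k) ψ p) (X : ℂ) :
    nabla (fun q => T q (ψ q)) p X =
      nabla (fun q => T q (ψ p)) p X + T p (nabla ψ p X) := by
  set b := Module.finBasis ℝ (HVec k)
  let l := fun i => LinearMap.toContinuousLinearMap (b.coord i)
  have hl : ∀ i v, l i v = b.coord i v := fun i v => rfl
  have inv : (chartAt ℂ p).symm (chartAt ℂ p p) = p :=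
    (chartAt ℂ p).left_inv (mem_chart_source ℂ p)
  -- the product rule in coordinates, used below for `ψ` and for the constant section `ψ p`
  have key : ∀ φ : M → HVec k, MDifferentiableAt 𝓘(ℝ, ℂ) 𝓘(ℝ, HVec k) φ p →
      nabla (fun q => T q (φ q)) p X = ∑ i, (b.coord i (φ p) • nabla (fun q => T q (b i)) p X +
        b.coord i (nabla φ p X) • T p (b i)) := by
    intro φ hφ
    have h1 : HasFDerivAt (fun z => ∑ i, l i ((φ ∘ (chartAt ℂ p).symm) z) •
        ((fun q => T q (b i)) ∘ (chartAt ℂ p).symm) z) _ (chartAt ℂ p p) :=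
      HasFDerivAt.fun_sum fun i _ =>
        ((l i).hasFDerivAt.comp _ (hasFDerivAt_nabla hφ)).smul (hasFDerivAt_nabla (hT (b i)))
    have h2 : ContinuousAt (fun q => T q (φ q)) p := by
      have e : (fun q => T q (φ q)) = fun q => ∑ i, l i (φ q) • T q (b i) :=
        funext fun q => linearMap_apply_eq_sum _ _
      rw [e]
      exact tendsto_finsetSum _ fun i _ =>
        ((l i).continuous.continuousAt.comp hφ.continuousAt).smul (hT (b i)).continuousAt
    have e3 : (fun q => T q (φ q)) ∘ (chartAt ℂ p).symm = fun z =>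
        ∑ i, l i ((φ ∘ (chartAt ℂ p).symm) z) •
        ((fun q => T q (b i)) ∘ (chartAt ℂ p).symm) z :=
      funext fun z => linearMap_apply_eq_sum _ _
    rw [← e3] at h1
    rw [nabla_eq_of_hasFDerivAt h2 h1]
    simp [inv, hl]
  rw [key ψ hψ, key (fun _ => ψ p) mdifferentiableAt_const]
  have h0 : nabla (fun _ : M => ψ p) p = 0 := mfderiv_const
  rw [h0, linearMap_apply_eq_sum (T p) (nabla ψ p X), Finset.sum_add_distrib]
  simp [b]

/-- The product rule `∇ (S ψ) = (∇ S) ψ + S ∇ ψ`. -/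
theorem nabla_end_apply {S : M → HEnd n} {ψ : M → HVec n} {p : M}
    (hS : ∀ v, ContMDiff 𝓘(ℝ, ℂ) 𝓘(ℝ, HVec n) ∞ (fun p => S p v))
    (hψ : MDifferentiableAt 𝓘(ℝ, ℂ) 𝓘(ℝ, HVec n) ψ p) (X : ℂ) :
    nabla (fun q => S q (ψ q)) p X = nablaEnd S p X (ψ p) + S p (nabla ψ p X) :=
  nabla_linearMap_apply (T := fun p => (S p).restrictScalars ℝ)
    (fun v => (hS v).mdifferentiable (by simp) p) hψ X

/-- Constant linear maps commute with `∇`. -/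
theorem nabla_const_linearMap_apply {k : ℕ} (T : HVec k →ₗ[ℝ] HVec n) {ψ : M → HVec k} {p : M}
    (hψ : MDifferentiableAt 𝓘(ℝ, ℂ) 𝓘(ℝ, HVec k) ψ p) (X : ℂ) :
    nabla (fun q => T (ψ q)) p X = T (nabla ψ p X) := by
  rw [nabla_linearMap_apply (T := fun _ => T) (fun v => mdifferentiableAt_const) hψ]
  have h0 : nabla (fun _ : M => T (ψ p)) p = 0 := mfderiv_const
  rw [h0, zero_apply, zero_add]

end Families

/-! ### Pulling back Frenet data by a local biholomorphism -/

section Pullback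

variable {M : Type*} [TopologicalSpace M] [ChartedSpace ℂ M]
  {C : Type*} [TopologicalSpace C] [ChartedSpace ℂ C] {n : ℕ} {π : C → M}

theorem contMDiff_of_isLocalDiffeomorph (hπ : IsLocalDiffeomorph 𝓘(ℂ) 𝓘(ℂ) ω π) :
    ContMDiff 𝓘(ℝ, ℂ) 𝓘(ℝ, ℂ) ∞ π :=
  contMDiffOn_univ.1 (contMDiffOn_real hπ.contMDiff.contMDiffOn)

theorem exists_localInverse (hπ : IsLocalDiffeomorph 𝓘(ℂ) 𝓘(ℂ) ω π) (x : C) :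
    ∃ (V : Set C) (U : Set M) (σ : M → C), IsOpen V ∧ IsOpen U ∧ x ∈ V ∧ π x ∈ U ∧
      ContMDiffOn 𝓘(ℝ, ℂ) 𝓘(ℝ, ℂ) ∞ σ U ∧ (∀ y ∈ V, π y ∈ U ∧ σ (π y) = y) ∧
      ∀ z ∈ U, σ z ∈ V ∧ π (σ z) = z := by
  obtain ⟨Φ, hx, he⟩ := hπ x
  have h1 : ∀ y ∈ Φ.source, π y ∈ Φ.target ∧ Φ.invFun (π y) = y := fun y hy => by
    rw [he hy]
    exact ⟨Φ.map_source' hy, Φ.left_inv' hy⟩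
  refine ⟨Φ.source, Φ.target, Φ.invFun, Φ.open_source, Φ.open_target, hx, (h1 x hx).1,
    contMDiffOn_real Φ.contMDiffOn_invFun, h1, fun z hz => ⟨Φ.map_target' hz, ?_⟩⟩
  rw [he (Φ.map_target' hz)]
  exact Φ.right_inv' hz

theorem tangentMapAt_surjective (hπ : IsLocalDiffeomorph 𝓘(ℂ) 𝓘(ℂ) ω π) (x : C) :
    Function.Surjective (tangentMapAt π x) := by
  obtain ⟨V, U, σ, -, hU, hx, -, hσ, hl, hr⟩ := exists_localInverse hπ x
  have hux := (hl x hx).1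
  have hsd : MDifferentiableAt 𝓘(ℝ, ℂ) 𝓘(ℝ, ℂ) σ (π x) :=
    (hσ.contMDiffAt (hU.mem_nhds hux)).mdifferentiableAt (by simp)
  have e : ∀ᶠ z in 𝓝 (π x), π (σ z) = z := by
    filter_upwards [hU.mem_nhds hux] with z hz using (hr z hz).2
  intro Y
  have := tangentMapAt_leftInverse
    ((contMDiff_of_isLocalDiffeomorph hπ).mdifferentiable (by simp) _) hsd e Y
  rw [(hl x hx).2] at this
  exact ⟨_, this⟩

theorem tangentMapAt_I_mul_of_isLocalDiffeomorph (hπ : IsLocalDiffeomorph 𝓘(ℂ) 𝓘(ℂ) ω π)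
    (x : C) (X : ℂ) :
    tangentMapAt π x (Complex.I * X) = Complex.I * tangentMapAt π x X :=
  tangentMapAt_I_mul (hπ.mdifferentiable (by simp) x) X

theorem IsSmoothSection.mdifferentiableAt {W : M → HSub n} {U : Set M} {ψ : M → HVec n}
    (h : IsSmoothSection W U ψ) (hU : IsOpen U) {p : M} (hp : p ∈ U) :
    MDifferentiableAt 𝓘(ℝ, ℂ) 𝓘(ℝ, HVec n) ψ p :=
  mdifferentiableAt_of_contMDiffOn hU h.1 hp

theorem IsSmoothSection.comp {W : M → HSub n} {U : Set M} {ψ : M → HVec n}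
    (h : IsSmoothSection W U ψ) (hπ : IsLocalDiffeomorph 𝓘(ℂ) 𝓘(ℂ) ω π) :
    IsSmoothSection (W ∘ π) (π ⁻¹' U) (ψ ∘ π) :=
  ⟨h.1.comp (contMDiff_of_isLocalDiffeomorph hπ).contMDiffOn fun _ hy => hy, fun _ hx => h.2 _ hx⟩

theorem IsSmoothSubbundle.comp {W : M → HSub n} {r : ℕ} (h : IsSmoothSubbundle W r)
    (hπ : IsLocalDiffeomorph 𝓘(ℂ) 𝓘(ℂ) ω π) : IsSmoothSubbundle (W ∘ π) r := by
  intro x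
  obtain ⟨U, hU, hx, e, hs, he⟩ := h (π x)
  exact ⟨π ⁻¹' U, hU.preimage (contMDiff_of_isLocalDiffeomorph hπ).continuous, hx,
    fun i => e i ∘ π, fun i => (hs i).comp hπ, fun q hq => he _ hq⟩

/-- Sections of a pulled back bundle are locally pulled back from the base. -/
theorem IsSmoothSection.exists_eventuallyEq_comp {W : M → HSub n} {U : Set C} {ψ : C → HVec n}
    (h : IsSmoothSection (W ∘ π) U ψ) (hU : IsOpen U)
    (hπ : IsLocalDiffeomorph 𝓘(ℂ) 𝓘(ℂ) ω π) {x : C} (hx : x ∈ U) :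
    ∃ (U' : Set M) (φ : M → HVec n), IsOpen U' ∧ π x ∈ U' ∧ IsSmoothSection W U' φ ∧
      ψ =ᶠ[𝓝 x] φ ∘ π := by
  obtain ⟨V, O, σ, hV, hO, hxV, hxO, hσ, hl, hr⟩ := exists_localInverse hπ x
  refine ⟨O ∩ σ ⁻¹' U, ψ ∘ σ, hσ.continuousOn.isOpen_inter_preimage hO hU,
    ⟨hxO, by rw [Set.mem_preimage, (hl x hxV).2]; exact hx⟩,
    ⟨h.1.comp (hσ.mono Set.inter_subset_left) fun y hy => hy.2, fun z hz => ?_⟩, ?_⟩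
  · have := h.2 _ hz.2
    rwa [Function.comp_apply, (hr z hz.1).2] at this
  · filter_upwards [hV.mem_nhds hxV] with y hy
    rw [Function.comp_apply, Function.comp_apply, (hl y hy).2]

theorem nabla_eq_of_eventuallyEq_comp (hπ : IsLocalDiffeomorph 𝓘(ℂ) 𝓘(ℂ) ω π)
    {ψ : C → HVec n} {φ : M → HVec n} {x : C} (e : ψ =ᶠ[𝓝 x] φ ∘ π)
    (hφ : MDifferentiableAt 𝓘(ℝ, ℂ) 𝓘(ℝ, HVec n) φ (π x)) (X : ℂ) :
    nabla ψ x X = nabla φ (π x) (tangentMapAt π x X) := by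
  rw [nabla_congr e,
    nabla_comp hφ ((contMDiff_of_isLocalDiffeomorph hπ).mdifferentiable (by simp) x)]
  rfl

theorem IsOsculatingFlag.comp {f : M → HP n} {V : ℕ → M → HSub n} (h : IsOsculatingFlag f V)
    (hπ : IsLocalDiffeomorph 𝓘(ℂ) 𝓘(ℂ) ω π) :
    IsOsculatingFlag (f ∘ π) (fun k => V k ∘ π) where
  zero_eq p := h.zero_eq (π p)
  smooth k hk := (h.smooth k hk).comp hπ
  le_succ k hk p := h.le_succ k hk (π p)
  nabla_mem k hk U ψ hU hψ p hp X := by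
    obtain ⟨U', φ, hU', hpU', hφ, e⟩ := hψ.exists_eventuallyEq_comp hU hπ hp
    rw [nabla_eq_of_eventuallyEq_comp hπ e (hφ.mdifferentiableAt hU' hpU')]
    exact h.nabla_mem k hk U' φ hU' hφ _ hpU' _

theorem IsAdaptedComplexStructure.comp {V : ℕ → M → HSub n} {S : M → HEnd n}
    (h : IsAdaptedComplexStructure V S) (hπ : IsLocalDiffeomorph 𝓘(ℂ) 𝓘(ℂ) ω π) :
    IsAdaptedComplexStructure (fun k => V k ∘ π) (S ∘ π) where
  smooth v := (h.smooth v).comp (contMDiff_of_isLocalDiffeomorph hπ)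
  sq p v := h.sq (π p) v
  stable k hk p := h.stable k hk (π p)
  star_eq_left k hk U ψ hU hψ p hp X := by
    obtain ⟨U', φ, hU', hpU', hφ, e⟩ := hψ.exists_eventuallyEq_comp hU hπ hp
    have hd := hφ.mdifferentiableAt hU' hpU'
    rw [secondFund, nabla_eq_of_eventuallyEq_comp hπ e hd,
      nabla_eq_of_eventuallyEq_comp hπ e hd, tangentMapAt_I_mul_of_isLocalDiffeomorph hπ]
    exact h.star_eq_left k hk U' φ hU' hφ _ hpU' _
  star_eq_right k hk U ψ hU hψ p hp X := by
    obtain ⟨U', φ, hU', hpU', hφ, e⟩ := hψ.exists_eventuallyEq_comp hU hπ hp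
    have hd := hφ.mdifferentiableAt hU' hpU'
    have e' : (fun q => (S ∘ π) q (ψ q)) =ᶠ[𝓝 p] (fun q => S q (φ q)) ∘ π := by
      filter_upwards [e] with y hy
      simp [hy]
    have hd' := mdifferentiableAt_of_contMDiffOn hU' (contMDiffOn_end_apply h.smooth hφ.1) hpU'
    rw [secondFund, secondFund, nabla_eq_of_eventuallyEq_comp hπ e hd,
      nabla_eq_of_eventuallyEq_comp hπ e' hd', tangentMapAt_I_mul_of_isLocalDiffeomorph hπ]
    exact h.star_eq_right k hk U' φ hU' hφ _ hpU' _

theorem nablaEnd_comp {S : M → HEnd n}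
    (hS : ∀ v, ContMDiff 𝓘(ℝ, ℂ) 𝓘(ℝ, HVec n) ∞ (fun p => S p v))
    (hπ : IsLocalDiffeomorph 𝓘(ℂ) 𝓘(ℂ) ω π) (x : C) (X : ℂ) (v : HVec n) :
    nablaEnd (S ∘ π) x X v = nablaEnd S (π x) (tangentMapAt π x X) v :=
  nabla_eq_of_eventuallyEq_comp hπ (φ := fun q => S q v) .rfl
    ((hS v).mdifferentiable (by simp) _) X

theorem hopfA_comp {S : M → HEnd n}
    (hS : ∀ v, ContMDiff 𝓘(ℝ, ℂ) 𝓘(ℝ, HVec n) ∞ (fun p => S p v))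
    (hπ : IsLocalDiffeomorph 𝓘(ℂ) 𝓘(ℂ) ω π) (x : C) (X : ℂ) (v : HVec n) :
    hopfA (S ∘ π) x X v = hopfA S (π x) (tangentMapAt π x X) v := by
  rw [hopfA, hopfA, nablaEnd_comp hS hπ, nablaEnd_comp hS hπ,
    tangentMapAt_I_mul_of_isLocalDiffeomorph hπ]
  rfl

theorem DerivVanishesAt.of_comp {W : M → HSub n} {x : C} (h : DerivVanishesAt (W ∘ π) x)
    (hπ : IsLocalDiffeomorph 𝓘(ℂ) 𝓘(ℂ) ω π) : DerivVanishesAt W (π x) := by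
  intro U ψ hU hx hψ Y
  obtain ⟨X, rfl⟩ := tangentMapAt_surjective hπ x Y
  have := h (π ⁻¹' U) (ψ ∘ π)
    (hU.preimage (contMDiff_of_isLocalDiffeomorph hπ).continuous) hx (hψ.comp hπ) X
  rw [secondFund, nabla_eq_of_eventuallyEq_comp hπ .rfl (hψ.mdifferentiableAt hU hx)] at this
  exact this

theorem tendsto_punctured_nhds_of_isLocalDiffeomorph (hπ : IsLocalDiffeomorph 𝓘(ℂ) 𝓘(ℂ) ω π)
    (x : C) : Filter.Tendsto π (𝓝[≠] x) (𝓝[≠] (π x)) := by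
  obtain ⟨V, U, σ, hV, -, hx, -, -, hl, -⟩ := exists_localInverse hπ x
  refine tendsto_nhdsWithin_iff.2
    ⟨((contMDiff_of_isLocalDiffeomorph hπ).continuous.tendsto x).mono_left nhdsWithin_le_nhds, ?_⟩
  filter_upwards [nhdsWithin_le_nhds (hV.mem_nhds hx), self_mem_nhdsWithin] with y hy hne heq
  apply hne
  have h1 := (hl y hy).2
  rw [heq, (hl x hx).2] at h1
  exact h1.symm

end Pullback

/-! ### Columns and coefficients -/

section Algebra

open MulOpposite

variable {n : ℕ}

/-- The quaternionic linear map `ℍ → ℍ^{n+1}`, `c ↦ w c`. -/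
noncomputable def column (w : HVec n) : ℍ[ℝ] →ₗ[ℍ[ℝ]ᵐᵒᵖ] HVec n where
  toFun c := op c • w
  map_add' a b := by rw [op_add, add_smul]
  map_smul' a c := by
    rw [RingHom.id_apply, smul_smul]
    rfl

theorem column_apply (w : HVec n) (c : ℍ[ℝ]) : column w c = op c • w := rfl

@[simp]
theorem column_one (w : HVec n) : column w 1 = w := by simp [column_apply]

theorem column_add (v w : HVec n) (c : ℍ[ℝ]) : column (v + w) c = column v c + column w c :=
  smul_add _ _ _

theorem column_smul (r : ℝ) (w : HVec n) (c : ℍ[ℝ]) : column (r • w) c = r • column w c :=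
  smul_comm _ _ _

theorem column_column (w : HVec n) (a c : ℍ[ℝ]) : column (column w a) c = column w (a * c) := by
  simp only [column_apply, smul_smul, op_mul]

theorem map_column {k : ℕ} (T : HVec n →ₗ[ℍ[ℝ]ᵐᵒᵖ] HVec k) (w : HVec n) (c : ℍ[ℝ]) :
    T (column w c) = column (T w) c := map_smul T _ _

theorem column_mem {W : HSub n} {w : HVec n} (hw : w ∈ W) (c : ℍ[ℝ]) : column w c ∈ W :=
  W.smul_mem _ hw

/-- The coefficient map `u ↦ (w* w)⁻¹ w* u`, a left inverse of `column w` for `w ≠ 0`. -/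
noncomputable def coeff (w : HVec n) : HVec n →ₗ[ℍ[ℝ]ᵐᵒᵖ] ℍ[ℝ] where
  toFun u := (∑ i, ‖w i‖ ^ 2)⁻¹ • ∑ i, star (w i) * u i
  map_add' u v := by simp [mul_add, Finset.sum_add_distrib]
  map_smul' a u := by
    simp only [Pi.smul_apply, MulOpposite.smul_eq_mul_unop, RingHom.id_apply]
    simp only [← mul_assoc, ← Finset.sum_mul, smul_mul_assoc]

theorem sum_norm_sq_ne_zero {w : HVec n} (hw : w ≠ 0) : ∑ i, ‖w i‖ ^ 2 ≠ 0 := by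
  intro h
  apply hw
  ext1 i
  have := (Finset.sum_eq_zero_iff_of_nonneg fun i _ => by positivity).1 h i (Finset.mem_univ i)
  simpa using this

theorem coeff_column {w : HVec n} (hw : w ≠ 0) (c : ℍ[ℝ]) : coeff w (column w c) = c := by
  have h : ∀ i, star (w i) * (column w c) i = (‖w i‖ ^ 2) • c := fun i => by
    change star (w i) * (w i * c) = _
    rw [← mul_assoc, Quaternion.star_mul_self, Quaternion.normSq_eq_norm_mul_self,
      Quaternion.coe_mul_eq_smul, sq]
  change (∑ i, ‖w i‖ ^ 2)⁻¹ • ∑ i, star (w i) * (column w c) i = c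
  simp only [h]
  rw [← Finset.sum_smul, inv_smul_smul₀ (sum_norm_sq_ne_zero hw)]

theorem column_injective {w : HVec n} (hw : w ≠ 0) : Function.Injective (column w) :=
  Function.LeftInverse.injective (coeff_column hw)

/-- A nonzero vector of a quaternionic line spans it. -/
theorem column_coeff_of_mem_line {x : HP n} {w u : HVec n} (hw : w ∈ x.submodule) (h0 : w ≠ 0)
    (hu : u ∈ x.submodule) : column w (coeff w u) = u := by
  rw [Projectivization.submodule_eq, Submodule.mem_span_singleton] at hw hu
  obtain ⟨a, ha⟩ := hw
  obtain ⟨b, hb⟩ := hu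
  have ha0 : a ≠ 0 := fun h => h0 (by rw [← ha, h, zero_smul])
  have : u = column w (unop (b * a⁻¹)) := by
    rw [column_apply, op_unop, ← ha, smul_smul, inv_mul_cancel_right₀ ha0, hb]
  rw [this, coeff_column h0]

theorem contDiff_star : ContDiff ℝ ∞ (star : ℍ[ℝ] → ℍ[ℝ]) :=
  (LinearMap.toContinuousLinearMap
    (⟨⟨star, star_add⟩, Quaternion.star_smul⟩ : ℍ[ℝ] →ₗ[ℝ] ℍ[ℝ])).contDiff

theorem contMDiffOn_coeff {M : Type*} [TopologicalSpace M] [ChartedSpace ℂ M] {U : Set M}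
    {w u : M → HVec n} (hw : ContMDiffOn 𝓘(ℝ, ℂ) 𝓘(ℝ, HVec n) ∞ w U)
    (hu : ContMDiffOn 𝓘(ℝ, ℂ) 𝓘(ℝ, HVec n) ∞ u U) (h0 : ∀ p ∈ U, w p ≠ 0) :
    ContMDiffOn 𝓘(ℝ, ℂ) 𝓘(ℝ, ℍ[ℝ]) ∞ (fun p => coeff (w p) (u p)) U := by
  have hwu : ContMDiffOn 𝓘(ℝ, ℂ) 𝓘(ℝ, HVec n × HVec n) ∞ (fun p => (w p, u p)) U :=
    hw.prodMk_space hu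
  have h : ContDiffOn ℝ ∞ (fun x : HVec n × HVec n =>
      (∑ i, ‖x.1 i‖ ^ 2)⁻¹ • ∑ i, star (x.1 i) * x.2 i) {x | x.1 ≠ 0} := by
    have c1 : ∀ i, ContDiff ℝ ∞ fun x : HVec n × HVec n => x.1 i := fun i =>
      (contDiff_apply ℝ ℍ[ℝ] i).comp contDiff_fst
    have c2 : ∀ i, ContDiff ℝ ∞ fun x : HVec n × HVec n => x.2 i := fun i =>
      (contDiff_apply ℝ ℍ[ℝ] i).comp contDiff_snd
    have c3 : ∀ i, ContDiff ℝ ∞ fun x : HVec n × HVec n => star (x.1 i) := fun i =>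
      contDiff_star.comp (c1 i)
    have d1 : ContDiff ℝ ∞ fun x : HVec n × HVec n => ∑ i, ‖x.1 i‖ ^ 2 :=
      ContDiff.sum fun i _ => (c1 i).norm_sq ℝ
    have d2 : ContDiff ℝ ∞ fun x : HVec n × HVec n => ∑ i, star (x.1 i) * x.2 i :=
      ContDiff.sum fun i _ => (c3 i).mul (c2 i)
    exact (d1.contDiffOn.inv fun x hx => sum_norm_sq_ne_zero hx).smul d2.contDiffOn
  refine (h.contMDiffOn.comp hwu h0).congr fun p _ => ?_
  rfl

end Algebra

/-! ### The affine chart -/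

section Affine

open MulOpposite

variable {m : ℕ}

/-- The first coordinates of a vector of `ℍ^{m+2} = ℍ^{m+1} ⊕ ℍ`. -/
noncomputable def initL (m : ℕ) : HVec (m + 1) →ₗ[ℍ[ℝ]ᵐᵒᵖ] HVec m :=
  LinearMap.funLeft ℍ[ℝ]ᵐᵒᵖ ℍ[ℝ] Fin.castSucc

/-- The last coordinate of a vector of `ℍ^{m+2} = ℍ^{m+1} ⊕ ℍ`. -/
noncomputable def lastL (m : ℕ) : HVec (m + 1) →ₗ[ℍ[ℝ]ᵐᵒᵖ] ℍ[ℝ] :=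
  LinearMap.proj (Fin.last (m + 1))

/-- The vector `(g, 1)`, which spans the point with affine coordinate `g`. -/
noncomputable def affinePoint (g : HVec m) : HVec (m + 1) :=
  Fin.snoc (α := fun _ => ℍ[ℝ]) g 1

/-- The projection of `ℍ^{m+2}` onto the hyperplane `ℍ^{m+1}` along the line spanned by
`(g, 1)`. -/
noncomputable def projAlong (g : HVec m) : HVec (m + 1) →ₗ[ℍ[ℝ]ᵐᵒᵖ] HVec m :=
  initL m - column g ∘ₗ lastL m

theorem initL_apply (y : HVec (m + 1)) (i : Fin (m + 1)) : initL m y i = y i.castSucc := rfl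

theorem lastL_apply (y : HVec (m + 1)) : lastL m y = y (Fin.last (m + 1)) := rfl

theorem projAlong_apply (g : HVec m) (y : HVec (m + 1)) :
    projAlong g y = initL m y - column g (lastL m y) := rfl

@[simp]
theorem initL_hyperplaneIncl (v : HVec m) : initL m (hyperplaneIncl m v) = v := by
  ext1 i
  simp [initL_apply, hyperplaneIncl]

@[simp]
theorem lastL_hyperplaneIncl (v : HVec m) : lastL m (hyperplaneIncl m v) = 0 := by
  simp [lastL_apply, hyperplaneIncl]

@[simp]
theorem initL_affinePoint (g : HVec m) : initL m (affinePoint g) = g := by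
  ext1 i
  simp [initL_apply, affinePoint]

@[simp]
theorem lastL_affinePoint (g : HVec m) : lastL m (affinePoint g) = 1 := by
  simp [lastL_apply, affinePoint]

@[simp]
theorem lastL_column (w : HVec (m + 1)) (c : ℍ[ℝ]) : lastL m (column w c) = lastL m w * c := rfl

theorem affinePoint_ne_zero (g : HVec m) : affinePoint g ≠ 0 := fun h => by
  have := lastL_affinePoint g
  rw [h, map_zero] at this
  exact zero_ne_one this

@[simp]
theorem projAlong_hyperplaneIncl (g v : HVec m) : projAlong g (hyperplaneIncl m v) = v := by
  simp [projAlong_apply]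

@[simp]
theorem projAlong_affinePoint (g : HVec m) : projAlong g (affinePoint g) = 0 := by
  simp [projAlong_apply]

theorem ext_init_last {y z : HVec (m + 1)} (h1 : initL m y = initL m z)
    (h2 : lastL m y = lastL m z) : y = z := by
  ext1 i
  refine Fin.lastCases h2 (fun j => ?_) i
  exact congrFun h1 j

theorem ext_projAlong_last (g : HVec m) {y z : HVec (m + 1)} (h1 : projAlong g y = projAlong g z)
    (h2 : lastL m y = lastL m z) : y = z := by
  refine ext_init_last ?_ h2
  rw [projAlong_apply, projAlong_apply, h2] at h1
  exact sub_left_injective h1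

/-- The decomposition `ℍ^{m+2} = ℍ^{m+1} ⊕ (g, 1) ℍ`. -/
theorem eq_hyperplaneIncl_add_column (g : HVec m) (y : HVec (m + 1)) :
    y = hyperplaneIncl m (projAlong g y) + column (affinePoint g) (lastL m y) := by
  refine ext_projAlong_last g ?_ ?_
  · simp [map_column, column_apply (0 : HVec m)]
  · simp

theorem ker_projAlong (g : HVec m) :
    LinearMap.ker (projAlong g) = Submodule.span ℍ[ℝ]ᵐᵒᵖ {affinePoint g} := by
  ext y
  rw [LinearMap.mem_ker, Submodule.mem_span_singleton]
  constructor
  · intro h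
    refine ⟨op (lastL m y), ?_⟩
    conv_rhs => rw [eq_hyperplaneIncl_add_column g y, h, map_zero, zero_add]
    rfl
  · rintro ⟨a, rfl⟩
    simp

/-- Left multiplication by a quaternion, as a right quaternionic linear map. -/
noncomputable def leftMul (a : ℍ[ℝ]) : ℍ[ℝ] →ₗ[ℍ[ℝ]ᵐᵒᵖ] ℍ[ℝ] where
  toFun c := a * c
  map_add' := mul_add a
  map_smul' b c := by
    simp only [MulOpposite.smul_eq_mul_unop, RingHom.id_apply, mul_assoc]

/-- The endomorphism of `ℍ^{m+2} = ℍ^{m+1} ⊕ (g, 1) ℍ` with block matrix `(T, 0; B, N)`. -/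
noncomputable def blockEnd (g : HVec m) (T : HEnd m) (N : ℍ[ℝ]) (B : HVec m →ₗ[ℍ[ℝ]ᵐᵒᵖ] ℍ[ℝ]) :
    HEnd (m + 1) :=
  hyperplaneIncl m ∘ₗ T ∘ₗ projAlong g +
    column (affinePoint g) ∘ₗ (leftMul N ∘ₗ lastL m + B ∘ₗ projAlong g)

theorem blockEnd_apply (g : HVec m) (T : HEnd m) (N : ℍ[ℝ]) (B : HVec m →ₗ[ℍ[ℝ]ᵐᵒᵖ] ℍ[ℝ])
    (y : HVec (m + 1)) : blockEnd g T N B y = hyperplaneIncl m (T (projAlong g y)) +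
      column (affinePoint g) (N * lastL m y + B (projAlong g y)) := rfl

@[simp]
theorem projAlong_blockEnd (g : HVec m) (T : HEnd m) (N : ℍ[ℝ]) (B : HVec m →ₗ[ℍ[ℝ]ᵐᵒᵖ] ℍ[ℝ])
    (y : HVec (m + 1)) : projAlong g (blockEnd g T N B y) = T (projAlong g y) := by
  rw [blockEnd_apply, map_add, map_column]
  simp [column_apply (0 : HVec m)]

@[simp]
theorem lastL_blockEnd (g : HVec m) (T : HEnd m) (N : ℍ[ℝ]) (B : HVec m →ₗ[ℍ[ℝ]ᵐᵒᵖ] ℍ[ℝ])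
    (y : HVec (m + 1)) : lastL m (blockEnd g T N B y) = N * lastL m y + B (projAlong g y) := by
  rw [blockEnd_apply, map_add]
  simp

theorem blockEnd_sq {g : HVec m} {T : HEnd m} {N : ℍ[ℝ]} {B : HVec m →ₗ[ℍ[ℝ]ᵐᵒᵖ] ℍ[ℝ]}
    (hT : ∀ v, T (T v) = -v) (hN : N * N = -1) (hB : ∀ v, B (T v) = -(N * B v))
    (y : HVec (m + 1)) : blockEnd g T N B (blockEnd g T N B y) = -y := by
  refine ext_projAlong_last g ?_ ?_
  · simp [hT]
  · simp [hB, mul_add, ← mul_assoc, hN]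

end Affine

/-! ### Hopf fields of complex structures -/

section Hopf

variable {M : Type*} [TopologicalSpace M] [ChartedSpace ℂ M] {n : ℕ} {S : M → HEnd n}

theorem end_real_smul (T : HEnd n) (r : ℝ) (u : HVec n) : T (r • u) = r • T u :=
  (T.restrictScalars ℝ).map_smul r u

theorem nablaEnd_add (hS : ∀ v, ContMDiff 𝓘(ℝ, ℂ) 𝓘(ℝ, HVec n) ∞ (fun p => S p v))
    (p : M) (X : ℂ) (v w : HVec n) :
    nablaEnd S p X (v + w) = nablaEnd S p X v + nablaEnd S p X w := by
  have e : (fun q => S q (v + w)) = (fun q => S q v) + fun q => S q w :=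
    funext fun q => map_add _ _ _
  have h := fun v => ((hS v).mdifferentiable (by simp) p).hasMFDerivAt
  have h2 : nabla ((fun q => S q v) + fun q => S q w) p =
      nabla (fun q => S q v) p + nabla (fun q => S q w) p := ((h v).add (h w)).mfderiv
  rw [nablaEnd, e, h2]
  rfl

theorem nablaEnd_smul (hS : ∀ v, ContMDiff 𝓘(ℝ, ℂ) 𝓘(ℝ, HVec n) ∞ (fun p => S p v))
    (p : M) (X : ℂ) (a : ℍ[ℝ]ᵐᵒᵖ) (v : HVec n) :
    nablaEnd S p X (a • v) = a • nablaEnd S p X v := by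
  let T : HVec n →ₗ[ℝ] HVec n :=
    { toFun := fun v => a • v
      map_add' := smul_add a
      map_smul' := fun r v => smul_comm _ _ _ }
  have e : (fun q => S q (a • v)) = fun q => T (S q v) := funext fun q => map_smul _ _ _
  rw [nablaEnd, e, nabla_const_linearMap_apply T ((hS v).mdifferentiable (by simp) p)]
  rfl

/-- The Hopf field `A` as a family of quaternionic endomorphisms. -/
noncomputable def hopfEnd (hS : ∀ v, ContMDiff 𝓘(ℝ, ℂ) 𝓘(ℝ, HVec n) ∞ (fun p => S p v))
    (p : M) (X : ℂ) : HEnd n where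
  toFun := hopfA S p X
  map_add' v w := by
    simp only [hopfA, nablaEnd_add hS, map_add]
    rw [← smul_add]
    congr 1
    abel
  map_smul' a v := by
    simp only [hopfA, nablaEnd_smul hS, map_smul, RingHom.id_apply]
    rw [← smul_add, smul_comm]

/-- `∇ S` anticommutes with `S`, since `S² = -1`. -/
theorem nablaEnd_apply_end (hS : ∀ v, ContMDiff 𝓘(ℝ, ℂ) 𝓘(ℝ, HVec n) ∞ (fun p => S p v))
    (hsq : ∀ p v, S p (S p v) = -v) (p : M) (X : ℂ) (v : HVec n) :
    nablaEnd S p X (S p v) = -S p (nablaEnd S p X v) := by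
  have h := nabla_end_apply hS ((hS v).mdifferentiable (by simp) p) X
  have e : (fun q => S q (S q v)) = fun _ => -v := funext fun q => hsq q v
  have h0 : nabla (fun _ : M => -v) p = 0 := mfderiv_const
  rw [e, h0] at h
  exact eq_neg_of_add_eq_zero_left h.symm

theorem hopfA_apply_end (hS : ∀ v, ContMDiff 𝓘(ℝ, ℂ) 𝓘(ℝ, HVec n) ∞ (fun p => S p v))
    (hsq : ∀ p v, S p (S p v) = -v) (p : M) (X : ℂ) (v : HVec n) :
    hopfA S p X (S p v) = -S p (hopfA S p X v) := by
  rw [hopfA, hopfA, nablaEnd_apply_end hS hsq, nablaEnd_apply_end hS hsq,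
    end_real_smul, ← smul_neg, map_add,
    map_neg, neg_add]

/-- The Hopf field is of type `(1,0)`: `*A = S A`. -/
theorem hopfA_I_mul (hsq : ∀ p v, S p (S p v) = -v) (p : M) (X : ℂ) (v : HVec n) :
    hopfA S p (Complex.I * X) v = S p (hopfA S p X v) := by
  have hI : Complex.I * (Complex.I * X) = -X := by
    rw [← mul_assoc, Complex.I_mul_I, neg_one_mul]
  have h : nablaEnd S p (-X) v = -nablaEnd S p X v := map_neg (nabla (fun q => S q v) p) X
  rw [hopfA, hopfA, hI, end_real_smul, map_add, hsq, h]
  congr 1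
  exact add_comm _ _

theorem hopfA_eq_re_add_im (p : M) (X : ℂ) (v : HVec n) :
    hopfA S p X v = X.re • hopfA S p 1 v + X.im • hopfA S p Complex.I v := by
  have h : ∀ Y : ℂ, nablaEnd S p (Y * X) v =
      X.re • nablaEnd S p Y v + X.im • nablaEnd S p (Y * Complex.I) v := fun Y => by
    have : Y * X = X.re • Y + X.im • (Y * Complex.I) := by
      conv_lhs => rw [← Complex.re_add_im X]
      simp only [Complex.real_smul]
      ring
    rw [this]
    simp only [nablaEnd, map_add, map_smul]
  have h1 := h 1
  simp only [one_mul] at h1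
  simp only [hopfA, h1, h Complex.I, map_add, end_real_smul, mul_one, smul_add]
  simp only [smul_comm (1 / 4 : ℝ)]
  abel

end Hopf

/-! ### The curve with a prescribed tangent curve -/

/-- The data of a map `g : M → ℍ^{m+1}`, regarded as the affine part of a curve in `ℍP^{m+1}`,
whose nowhere vanishing differential is a holomorphic form with values in the line bundle of a
curve `ft` with Frenet flag `V` and canonical complex structure `S`. -/
structure IsAffineLift {M : Type*} [TopologicalSpace M] [ChartedSpace ℂ M] {m : ℕ}
    (ft : M → HP m) (V : ℕ → M → HSub m) (S : M → HEnd m) (g : M → HVec m) : Prop where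
  flag : IsOsculatingFlag ft V
  adapted : IsAdaptedComplexStructure V S
  canonical : ∀ (p : M) (X : ℂ) (v : HVec m), hopfA S p X v ∈ line ft p
  smooth : ContMDiff 𝓘(ℝ, ℂ) 𝓘(ℝ, HVec m) ∞ g
  mem_line : ∀ p X, nabla g p X ∈ line ft p
  star_eq : ∀ p X, nabla g p (Complex.I * X) = S p (nabla g p X)
  ne_zero : ∀ p, nabla g p ≠ 0

/-- The complex structure `N` on the line bundle of `(g, 1)`, with `*dg = S dg = dg N`. -/
noncomputable def rightNormal {M : Type*} [TopologicalSpace M] [ChartedSpace ℂ M] {m : ℕ}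
    (S : M → HEnd m) (g : M → HVec m) (p : M) : ℍ[ℝ] :=
  coeff (nabla g p 1) (S p (nabla g p 1))

/-- The solution `B` of `*dg B = -2 A`, where `A` is the Hopf field of `S`. -/
noncomputable def offDiag {M : Type*} [TopologicalSpace M] [ChartedSpace ℂ M] {m : ℕ}
    {S : M → HEnd m} (hS : ∀ v, ContMDiff 𝓘(ℝ, ℂ) 𝓘(ℝ, HVec m) ∞ (fun p => S p v))
    (g : M → HVec m) (p : M) : HVec m →ₗ[ℍ[ℝ]ᵐᵒᵖ] ℍ[ℝ] :=
  coeff (nabla g p Complex.I) ∘ₗ ((-2 : ℝ) • hopfEnd hS p 1)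

namespace IsAffineLift

variable {M : Type*} [TopologicalSpace M] [ChartedSpace ℂ M] {m : ℕ}
  {ft : M → HP m} {V : ℕ → M → HSub m} {S : M → HEnd m} {g : M → HVec m}

section Pointwise

variable (H : IsAffineLift ft V S g)
include H

theorem nabla_apply (p : M) (X : ℂ) :
    nabla g p X = X.re • nabla g p 1 + X.im • S p (nabla g p 1) := by
  have : X = X.re • (1 : ℂ) + X.im • (Complex.I * 1) := by
    conv_lhs => rw [← Complex.re_add_im X]
    simp
  conv_lhs => rw [this]
  rw [map_add, map_smul, map_smul, H.star_eq]

theorem nabla_one_ne_zero (p : M) : nabla g p 1 ≠ 0 := fun h => by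
  apply H.ne_zero p
  ext1 X
  rw [H.nabla_apply, h]
  simp

/-- A nonzero form of type `(1,0)` is injective, by `*dg = S dg`. -/
theorem nabla_apply_ne_zero (p : M) {X : ℂ} (hX : X ≠ 0) : nabla g p X ≠ 0 := fun h => by
  -- the kernel is invariant under `J`, hence under multiplication by complex numbers
  apply H.nabla_one_ne_zero p
  have h1 : nabla g p (Complex.I * X) = 0 := by rw [H.star_eq, h, map_zero]
  have : (1 : ℂ) = (X⁻¹).re • X + (X⁻¹).im • (Complex.I * X) := by
    conv_lhs => rw [← inv_mul_cancel₀ hX, ← Complex.re_add_im X⁻¹]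
    simp only [Complex.real_smul]
    ring
  rw [this, map_add, map_smul, map_smul, h, h1]
  simp

theorem column_rightNormal_one (p : M) :
    column (nabla g p 1) (rightNormal S g p) = S p (nabla g p 1) :=
  column_coeff_of_mem_line (H.mem_line p 1) (H.nabla_one_ne_zero p)
    (by rw [← H.star_eq]; exact H.mem_line p _)

theorem rightNormal_mul_self (p : M) : rightNormal S g p * rightNormal S g p = -1 := by
  apply column_injective (H.nabla_one_ne_zero p)
  rw [← column_column, H.column_rightNormal_one, ← map_column, H.column_rightNormal_one,
    H.adapted.sq, map_neg, column_one]

theorem column_rightNormal (p : M) (X : ℂ) :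
    column (nabla g p X) (rightNormal S g p) = S p (nabla g p X) := by
  rw [H.nabla_apply p X, column_add, column_smul, column_smul, ← map_column,
    H.column_rightNormal_one, map_add, end_real_smul, end_real_smul]

theorem rightNormal_eq (p : M) {X : ℂ} (hX : X ≠ 0) :
    rightNormal S g p = coeff (nabla g p X) (S p (nabla g p X)) := by
  rw [← H.column_rightNormal, coeff_column (H.nabla_apply_ne_zero p hX)]

theorem column_offDiag (p : M) (X : ℂ) (v : HVec m) :
    column (nabla g p (Complex.I * X)) (offDiag H.adapted.smooth g p v) =
      (-2 : ℝ) • hopfA S p X v := by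
  have h1 : column (nabla g p Complex.I) (offDiag H.adapted.smooth g p v) =
      (-2 : ℝ) • hopfA S p 1 v :=
    column_coeff_of_mem_line (H.mem_line p _) (H.nabla_apply_ne_zero p Complex.I_ne_zero)
      (((line ft p).restrictScalars ℝ).smul_mem _ (H.canonical p 1 v))
  have h2 : hopfA S p Complex.I v = S p (hopfA S p 1 v) := by
    rw [← hopfA_I_mul H.adapted.sq, mul_one]
  have h3 : nabla g p (Complex.I * X) =
      X.re • nabla g p Complex.I + X.im • S p (nabla g p Complex.I) := by
    have e : nabla g p Complex.I = S p (nabla g p 1) := by rw [← H.star_eq, mul_one]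
    rw [H.star_eq, H.nabla_apply p X, map_add, end_real_smul, end_real_smul, e]
  rw [h3, column_add, column_smul, column_smul, ← map_column, h1, hopfA_eq_re_add_im p X v, h2,
    end_real_smul, smul_add, smul_comm (-2 : ℝ), smul_comm (-2 : ℝ)]

/-- The relation `B S + N B = 0`, which holds because `A` anticommutes with `S`. -/
theorem offDiag_apply_end (p : M) (v : HVec m) :
    offDiag H.adapted.smooth g p (S p v) =
      -(rightNormal S g p * offDiag H.adapted.smooth g p v) := by
  apply column_injective (H.nabla_apply_ne_zero p (X := Complex.I * 1) (by simp))
  rw [H.column_offDiag, map_neg, ← column_column, H.column_rightNormal, ← map_column,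
    H.column_offDiag, hopfA_apply_end H.adapted.smooth H.adapted.sq, end_real_smul, smul_neg]

theorem offDiag_eq (p : M) {X : ℂ} (hX : X ≠ 0) (v : HVec m) :
    offDiag H.adapted.smooth g p v =
      coeff (nabla g p (Complex.I * X)) ((-2 : ℝ) • hopfA S p X v) := by
  rw [← H.column_offDiag, coeff_column (H.nabla_apply_ne_zero p (by simp [hX]))]

end Pointwise

section Smoothness

variable [IsManifold 𝓘(ℂ) ω M] (H : IsAffineLift ft V S g)
include H

/-- The tangent vector `1` of the preferred charts does not vary smoothly with the point, but
`rightNormal` can be computed from the coordinate field of a fixed chart instead. -/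
theorem contMDiff_rightNormal : ContMDiff 𝓘(ℝ, ℂ) 𝓘(ℝ, ℍ[ℝ]) ∞ (rightNormal S g) := by
  intro p
  have ho := (chartAt ℂ p).open_source
  have h1 := (contMDiffOn_nabla_coordField p H.smooth).1
  refine ((contMDiffOn_coeff h1 (contMDiffOn_end_apply H.adapted.smooth h1) fun q hq =>
    H.nabla_apply_ne_zero q (coordField_ne_zero hq)).congr fun q hq => ?_).contMDiffAt
      (ho.mem_nhds (mem_chart_source ℂ p))
  exact H.rightNormal_eq q (coordField_ne_zero hq)

theorem contMDiff_offDiag (v : HVec m) :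
    ContMDiff 𝓘(ℝ, ℂ) 𝓘(ℝ, ℍ[ℝ]) ∞ (fun p => offDiag H.adapted.smooth g p v) := by
  intro p
  have ho := (chartAt ℂ p).open_source
  have h1 := (contMDiffOn_nabla_coordField p H.smooth).2
  have h2 := contMDiffOn_nabla_coordField p (H.adapted.smooth v)
  have hc : ∀ r : ℝ, ContMDiff 𝓘(ℝ, HVec m) 𝓘(ℝ, HVec m) ∞ fun u => r • u := fun r =>
    (contDiff_const_smul r).contMDiff
  have h3 : ContMDiffOn 𝓘(ℝ, ℂ) 𝓘(ℝ, HVec m) ∞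
      (fun q => (-2 : ℝ) • hopfA S q (coordField p q) v) (chartAt ℂ p).source :=
    (hc _).comp_contMDiffOn ((hc _).comp_contMDiffOn
      (h2.2.add (contMDiffOn_end_apply H.adapted.smooth h2.1)))
  refine ((contMDiffOn_coeff h1 h3 fun q hq => H.nabla_apply_ne_zero q
    (by simp [coordField_ne_zero hq])).congr fun q hq => ?_).contMDiffAt
      (ho.mem_nhds (mem_chart_source ℂ p))
  exact H.offDiag_eq q (coordField_ne_zero hq) v

end Smoothness

end IsAffineLift

/-! ### Flag and complex structure of the lifted curve -/

section Lift

variable {M : Type*} {m : ℕ}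

/-- The curve with affine coordinate `g`. -/
noncomputable def affineCurve (g : M → HVec m) (p : M) : HP (m + 1) :=
  Projectivization.mk _ (affinePoint (g p)) (affinePoint_ne_zero _)

theorem line_affineCurve (g : M → HVec m) (p : M) :
    line (affineCurve g) p = Submodule.span ℍ[ℝ]ᵐᵒᵖ {affinePoint (g p)} :=
  Projectivization.submodule_mk _ _

/-- The flag `V` with the zero bundle put in front. -/
noncomputable def shiftedFlag (V : ℕ → M → HSub m) : ℕ → M → HSub m
  | 0 => fun _ => ⊥
  | k + 1 => V k

/-- The bundle of vectors that the projection along `(g, 1)` maps to `W`. -/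
noncomputable def liftBundle (W : M → HSub m) (g : M → HVec m) (p : M) : HSub (m + 1) :=
  (W p).comap (projAlong (g p))

/-- The flag `L ⊂ L ⊕ V 0 ⊂ L ⊕ V 1 ⊂ ⋯`, where `L` is spanned by `(g, 1)`. -/
noncomputable def liftFlag (V : ℕ → M → HSub m) (g : M → HVec m) (k : ℕ) : M → HSub (m + 1) :=
  liftBundle (shiftedFlag V k) g

theorem mem_liftBundle {W : M → HSub m} {g : M → HVec m} {p : M} {y : HVec (m + 1)} :
    y ∈ liftBundle W g p ↔ projAlong (g p) y ∈ W p := Iff.rfl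

theorem liftFlag_zero (V : ℕ → M → HSub m) (g : M → HVec m) (p : M) :
    liftFlag V g 0 p = line (affineCurve g) p := by
  rw [line_affineCurve, ← ker_projAlong]
  rfl

variable [TopologicalSpace M] [ChartedSpace ℂ M]

theorem contMDiffOn_column {n : ℕ} {U : Set M} {w : M → HVec n} {c : M → ℍ[ℝ]}
    (hw : ContMDiffOn 𝓘(ℝ, ℂ) 𝓘(ℝ, HVec n) ∞ w U) (hc : ContMDiffOn 𝓘(ℝ, ℂ) 𝓘(ℝ, ℍ[ℝ]) ∞ c U) :
    ContMDiffOn 𝓘(ℝ, ℂ) 𝓘(ℝ, HVec n) ∞ (fun p => column (w p) (c p)) U := by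
  refine contMDiffOn_linearMap_apply (T := fun p => (column (w p)).restrictScalars ℝ)
    (fun a => ?_) hc
  let T : HVec n →ₗ[ℝ] HVec n :=
    { toFun := fun v => column v a
      map_add' := fun v w => column_add v w a
      map_smul' := fun r v => column_smul r v a }
  exact contMDiffOn_linearMap_apply (T := fun _ => T) (fun v => contMDiffOn_const) hw

theorem contMDiffOn_hyperplaneIncl {U : Set M} {w : M → HVec m}
    (hw : ContMDiffOn 𝓘(ℝ, ℂ) 𝓘(ℝ, HVec m) ∞ w U) :
    ContMDiffOn 𝓘(ℝ, ℂ) 𝓘(ℝ, HVec (m + 1)) ∞ (fun p => hyperplaneIncl m (w p)) U :=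
  contMDiffOn_linearMap_apply (T := fun _ => (hyperplaneIncl m).restrictScalars ℝ)
    (fun _ => contMDiffOn_const) hw

theorem contMDiffOn_initL {U : Set M} {φ : M → HVec (m + 1)}
    (hφ : ContMDiffOn 𝓘(ℝ, ℂ) 𝓘(ℝ, HVec (m + 1)) ∞ φ U) :
    ContMDiffOn 𝓘(ℝ, ℂ) 𝓘(ℝ, HVec m) ∞ (fun p => initL m (φ p)) U :=
  contMDiffOn_linearMap_apply (T := fun _ => (initL m).restrictScalars ℝ)
    (fun _ => contMDiffOn_const) hφ

theorem contMDiffOn_lastL {U : Set M} {φ : M → HVec (m + 1)}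
    (hφ : ContMDiffOn 𝓘(ℝ, ℂ) 𝓘(ℝ, HVec (m + 1)) ∞ φ U) :
    ContMDiffOn 𝓘(ℝ, ℂ) 𝓘(ℝ, ℍ[ℝ]) ∞ (fun p => lastL m (φ p)) U :=
  contMDiffOn_linearMap_apply (T := fun _ => (lastL m).restrictScalars ℝ)
    (fun _ => contMDiffOn_const) hφ

theorem contMDiffOn_projAlong {U : Set M} {g : M → HVec m} {φ : M → HVec (m + 1)}
    (hg : ContMDiffOn 𝓘(ℝ, ℂ) 𝓘(ℝ, HVec m) ∞ g U)
    (hφ : ContMDiffOn 𝓘(ℝ, ℂ) 𝓘(ℝ, HVec (m + 1)) ∞ φ U) :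
    ContMDiffOn 𝓘(ℝ, ℂ) 𝓘(ℝ, HVec m) ∞ (fun p => projAlong (g p) (φ p)) U :=
  (contMDiffOn_initL hφ).sub (contMDiffOn_column hg (contMDiffOn_lastL hφ))

theorem contMDiffOn_affinePoint {U : Set M} {g : M → HVec m}
    (hg : ContMDiffOn 𝓘(ℝ, ℂ) 𝓘(ℝ, HVec m) ∞ g U) :
    ContMDiffOn 𝓘(ℝ, ℂ) 𝓘(ℝ, HVec (m + 1)) ∞ (fun p => affinePoint (g p)) U := by
  have e : ∀ p, affinePoint (g p) = hyperplaneIncl m (g p) + affinePoint 0 := fun p =>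
    ext_init_last (by simp) (by simp)
  simp only [e]
  exact (contMDiffOn_hyperplaneIncl hg).add contMDiffOn_const

/-- The projection along `(g, 1)` commutes with `∇` up to the term `dg` that comes from
`∇ (g, 1) = (dg, 0)`. -/
theorem projAlong_nabla {g : M → HVec m} {φ : M → HVec (m + 1)} {p : M}
    (hg : ContMDiff 𝓘(ℝ, ℂ) 𝓘(ℝ, HVec m) ∞ g)
    (hφ : MDifferentiableAt 𝓘(ℝ, ℂ) 𝓘(ℝ, HVec (m + 1)) φ p) (X : ℂ) :
    projAlong (g p) (nabla φ p X) =
      nabla (fun q => projAlong (g q) (φ q)) p X + column (nabla g p X) (lastL m (φ p)) := by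
  have hgp := hg.mdifferentiable (by simp) p
  have hs : ∀ v, MDifferentiableAt 𝓘(ℝ, ℂ) 𝓘(ℝ, HVec m) (fun q => projAlong (g q) v) p :=
    fun v => mdifferentiableAt_of_contMDiffOn isOpen_univ
      (contMDiffOn_projAlong hg.contMDiffOn contMDiffOn_const) (Set.mem_univ p)
  have hprod := nabla_linearMap_apply (T := fun q => (projAlong (g q)).restrictScalars ℝ) hs hφ X
  let T : HVec m →ₗ[ℝ] HVec m :=
    { toFun := fun v => column v (lastL m (φ p))
      map_add' := fun v w => column_add v w _
      map_smul' := fun r v => column_smul r v _ }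
  have hT : MDifferentiableAt 𝓘(ℝ, ℂ) 𝓘(ℝ, HVec m) (fun q => T (g q)) p :=
    mdifferentiableAt_of_contMDiffOn isOpen_univ
      (contMDiffOn_column hg.contMDiffOn contMDiffOn_const) (Set.mem_univ p)
  have h1 : nabla (fun q => initL m (φ p) - T (g q)) p X =
      -column (nabla g p X) (lastL m (φ p)) := by
    have h0 : nabla (fun _ : M => initL m (φ p)) p = 0 := mfderiv_const
    rw [nabla_sub mdifferentiableAt_const hT, h0, zero_sub]
    exact congrArg Neg.neg (nabla_const_linearMap_apply T hgp X)
  have h2 : nabla (fun q => projAlong (g q) (φ q)) p X =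
      -column (nabla g p X) (lastL m (φ p)) + projAlong (g p) (nabla φ p X) :=
    hprod.trans (congrArg (· + projAlong (g p) (nabla φ p X)) h1)
  rw [h2]
  abel

theorem IsSmoothSection.projAlong {W : M → HSub m} {g : M → HVec m} {U : Set M}
    {φ : M → HVec (m + 1)} (h : IsSmoothSection (liftBundle W g) U φ)
    (hg : ContMDiff 𝓘(ℝ, ℂ) 𝓘(ℝ, HVec m) ∞ g) :
    IsSmoothSection W U (fun q => projAlong (g q) (φ q)) :=
  ⟨contMDiffOn_projAlong hg.contMDiffOn h.1, h.2⟩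

theorem IsSmoothSubbundle.liftBundle {W : M → HSub m} {r : ℕ} (h : IsSmoothSubbundle W r)
    {g : M → HVec m} (hg : ContMDiff 𝓘(ℝ, ℂ) 𝓘(ℝ, HVec m) ∞ g) :
    IsSmoothSubbundle (liftBundle W g) (r + 1) := by
  intro p
  obtain ⟨U, hU, hp, e, hs, he⟩ := h p
  refine ⟨U, hU, hp, Fin.cons (fun q => affinePoint (g q)) fun i q => hyperplaneIncl m (e i q),
    fun i => ?_, fun q hq => ?_⟩
  · refine Fin.cases ⟨contMDiffOn_affinePoint hg.contMDiffOn, fun q _ => ?_⟩ (fun j => ?_) i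
    · simp [mem_liftBundle]
    · exact ⟨contMDiffOn_hyperplaneIncl (hs j).1, fun q hq => by
        simpa [mem_liftBundle] using (hs j).2 q hq⟩
  · have e1 : (fun i => (Fin.cons (fun q => affinePoint (g q))
        (fun i q => hyperplaneIncl m (e i q)) : Fin (r + 1) → M → HVec (m + 1)) i q) =
        Fin.cons (affinePoint (g q)) (hyperplaneIncl m ∘ fun i => e i q) := by
      funext i
      refine Fin.cases rfl (fun j => rfl) i
    have hsp : Submodule.span ℍ[ℝ]ᵐᵒᵖ (Set.range (hyperplaneIncl m ∘ fun i => e i q)) =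
        (W q).map (hyperplaneIncl m) := by
      rw [Set.range_comp, ← Submodule.map_span, (he q hq).2]
    rw [e1, linearIndependent_finCons, Fin.range_cons, Submodule.span_insert, hsp]
    refine ⟨⟨(he q hq).1.map' _ (LinearMap.ker_eq_bot.2 fun v w hvw => ?_), ?_⟩, ?_⟩
    · have := congrArg (initL m) hvw
      simpa using this
    · rintro ⟨v, -, hv⟩
      have := congrArg (lastL m) hv
      simp at this
    · apply le_antisymm
      · refine sup_le ?_ ?_
        · rw [Submodule.span_singleton_le_iff_mem, mem_liftBundle]
          simp
        · rintro _ ⟨v, hv, rfl⟩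
          rw [mem_liftBundle]
          simpa using hv
      · intro y hy
        rw [eq_hyperplaneIncl_add_column (g q) y]
        exact add_mem (Submodule.mem_sup_right ⟨_, hy, rfl⟩)
          (Submodule.mem_sup_left (column_mem (Submodule.mem_span_singleton_self _) _))

theorem nabla_eq_zero_of_isSmoothSection_bot {n : ℕ} {U : Set M} {ψ : M → HVec n}
    (hU : IsOpen U) (h : IsSmoothSection (fun _ => ⊥) U ψ) {p : M} (hp : p ∈ U) :
    nabla ψ p = 0 := by
  have e : ψ =ᶠ[𝓝 p] fun _ => 0 := by
    filter_upwards [hU.mem_nhds hp] with q hq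
    exact (Submodule.mem_bot _).1 (h.2 q hq)
  rw [nabla_congr e]
  exact mfderiv_const

/-- The complex structure on the trivial bundle that is `N` on the line bundle `L` of `(g, 1)`
and `S` modulo `L`, with the off-diagonal part chosen to make its Hopf field `L`-valued. -/
noncomputable def liftStructure {S : M → HEnd m}
    (hS : ∀ v, ContMDiff 𝓘(ℝ, ℂ) 𝓘(ℝ, HVec m) ∞ (fun p => S p v))
    (g : M → HVec m) (p : M) : HEnd (m + 1) :=
  blockEnd (g p) (S p) (rightNormal S g p) (offDiag hS g p)

end Lift

namespace IsAffineLift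

variable {M : Type*} [TopologicalSpace M] [ChartedSpace ℂ M] [IsManifold 𝓘(ℂ) ω M] {m : ℕ}
  {ft : M → HP m} {V : ℕ → M → HSub m} {S : M → HEnd m} {g : M → HVec m}

theorem contMDiff_liftStructure (H : IsAffineLift ft V S g) (v : HVec (m + 1)) :
    ContMDiff 𝓘(ℝ, ℂ) 𝓘(ℝ, HVec (m + 1)) ∞ (fun p => liftStructure H.adapted.smooth g p v) := by
  rw [← contMDiffOn_univ]
  have hp := contMDiffOn_projAlong (U := Set.univ) H.smooth.contMDiffOn (contMDiffOn_const (c := v))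
  refine (contMDiffOn_hyperplaneIncl (contMDiffOn_end_apply H.adapted.smooth hp)).add
    (contMDiffOn_column (contMDiffOn_affinePoint H.smooth.contMDiffOn) (.add ?_ ?_))
  · have hm : ContMDiff 𝓘(ℝ, ℍ[ℝ]) 𝓘(ℝ, ℍ[ℝ]) ∞ fun a : ℍ[ℝ] => a * lastL m v :=
      (contDiff_id.mul contDiff_const).contMDiff
    exact hm.comp_contMDiffOn H.contMDiff_rightNormal.contMDiffOn
  · exact contMDiffOn_linearMap_apply
      (T := fun q => (offDiag H.adapted.smooth g q).restrictScalars ℝ)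
      (fun w => (H.contMDiff_offDiag w).contMDiffOn) hp

omit [IsManifold 𝓘(ℂ) ω M] in
theorem line_le_flag (H : IsAffineLift ft V S g) {k : ℕ} (hk : k ≤ m) (p : M) :
    line ft p ≤ V k p := by
  induction k with
  | zero => exact (H.flag.zero_eq p).ge
  | succ k ih => exact (ih (by omega)).trans (H.flag.le_succ k (by omega) p)

omit [IsManifold 𝓘(ℂ) ω M] in
theorem isOsculatingFlag_liftFlag (H : IsAffineLift ft V S g) :
    IsOsculatingFlag (affineCurve g) (liftFlag V g) where
  zero_eq p := liftFlag_zero V g p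
  smooth k hk := by
    refine IsSmoothSubbundle.liftBundle ?_ H.smooth
    cases k with
    | zero =>
      refine fun p => ⟨Set.univ, isOpen_univ, trivial, Fin.elim0, fun i => i.elim0, fun q _ => ?_⟩
      exact ⟨linearIndependent_empty_type, by simp [shiftedFlag]⟩
    | succ k => exact H.flag.smooth k (by omega)
  le_succ k hk p := by
    refine Submodule.comap_mono ?_
    cases k with
    | zero => exact bot_le
    | succ k => exact H.flag.le_succ k (by omega) p
  nabla_mem k hk U φ hU hφ p hp X := by
    have hs := hφ.projAlong H.smooth
    change projAlong (g p) (nabla φ p X) ∈ V k p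
    rw [projAlong_nabla H.smooth (hφ.mdifferentiableAt hU hp)]
    refine add_mem ?_ (column_mem (H.line_le_flag (by omega) p (H.mem_line p X)) _)
    cases k with
    | zero =>
      rw [nabla_eq_zero_of_isSmoothSection_bot hU hs hp]
      exact zero_mem _
    | succ k => exact H.flag.nabla_mem k (by omega) U _ hU hs p hp X

omit [IsManifold 𝓘(ℂ) ω M] in
theorem projAlong_nabla_liftStructure (H : IsAffineLift ft V S g) {φ : M → HVec (m + 1)} {p : M}
    (hφ : MDifferentiableAt 𝓘(ℝ, ℂ) 𝓘(ℝ, HVec (m + 1))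
      (fun q => liftStructure H.adapted.smooth g q (φ q)) p) (X : ℂ) :
    projAlong (g p) (nabla (fun q => liftStructure H.adapted.smooth g q (φ q)) p X) =
      nabla (fun q => S q (projAlong (g q) (φ q))) p X +
        (S p (column (nabla g p X) (lastL m (φ p))) +
          column (nabla g p X) (offDiag H.adapted.smooth g p (projAlong (g p) (φ p)))) := by
  rw [projAlong_nabla H.smooth hφ]
  simp only [liftStructure, projAlong_blockEnd, lastL_blockEnd, map_add]
  rw [← column_column, H.column_rightNormal, map_column]

theorem isAdaptedComplexStructure_lift (H : IsAffineLift ft V S g) :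
    IsAdaptedComplexStructure (liftFlag V g) (liftStructure H.adapted.smooth g) where
  smooth := H.contMDiff_liftStructure
  sq p := blockEnd_sq (H.adapted.sq p) (H.rightNormal_mul_self p) (H.offDiag_apply_end p)
  stable k hk p y hy := by
    change projAlong (g p) (liftStructure _ g p y) ∈ shiftedFlag V k p
    rw [liftStructure, projAlong_blockEnd]
    replace hy : projAlong (g p) y ∈ shiftedFlag V k p := hy
    cases k with
    | zero =>
      rw [(Submodule.mem_bot _).1 hy, map_zero]
      exact zero_mem _
    | succ k => exact H.adapted.stable k (by omega) p _ hy
  star_eq_left k hk U φ hU hφ p hp X := by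
    have hs := hφ.projAlong H.smooth
    have hd := hφ.mdifferentiableAt hU hp
    refine (Submodule.Quotient.eq _).2 ?_
    change projAlong (g p) _ ∈ shiftedFlag V k p
    rw [map_sub, liftStructure, projAlong_blockEnd, projAlong_nabla H.smooth hd,
      projAlong_nabla H.smooth hd, map_add, map_column, H.star_eq, add_sub_add_right_eq_sub]
    cases k with
    | zero =>
      rw [nabla_eq_zero_of_isSmoothSection_bot hU hs hp]
      simp
    | succ k =>
      exact (Submodule.Quotient.eq _).1 (H.adapted.star_eq_left k (by omega) U _ hU hs p hp X)
  star_eq_right k hk U φ hU hφ p hp X := by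
    have hs := hφ.projAlong H.smooth
    have hd := hφ.mdifferentiableAt hU hp
    have hd' := mdifferentiableAt_of_contMDiffOn hU
      (contMDiffOn_end_apply H.contMDiff_liftStructure hφ.1) hp
    refine (Submodule.Quotient.eq _).2 ?_
    change projAlong (g p) _ ∈ shiftedFlag V k p
    rw [map_sub, H.projAlong_nabla_liftStructure hd', projAlong_nabla H.smooth hd, map_column,
      H.star_eq, ← add_assoc, ← sub_sub, add_sub_add_right_eq_sub]
    cases k with
    | zero =>
      have hs' : IsSmoothSection (fun _ => ⊥) U fun q => S q (projAlong (g q) (φ q)) :=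
        ⟨contMDiffOn_end_apply H.adapted.smooth hs.1, fun q hq => by
          have h0 : projAlong (g q) (φ q) = 0 := (Submodule.mem_bot _).1 (hs.2 q hq)
          exact (Submodule.mem_bot _).2 (by simp only [h0, map_zero])⟩
      have h0 : projAlong (g p) (φ p) = 0 := (Submodule.mem_bot _).1 (hs.2 p hp)
      rw [nabla_eq_zero_of_isSmoothSection_bot hU hs hp,
        nabla_eq_zero_of_isSmoothSection_bot hU hs' hp, h0]
      simp
    | succ k =>
      exact sub_mem
        ((Submodule.Quotient.eq _).1 (H.adapted.star_eq_right k (by omega) U _ hU hs p hp X))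
        (column_mem (H.line_le_flag (by omega) p (H.mem_line p X)) _)

/-- The off-diagonal part of the lifted complex structure is what makes its Hopf field take
values in the line bundle: modulo `L`, the Hopf field is `A + ½ *dg B = 0`. -/
theorem hopfA_liftStructure_mem (H : IsAffineLift ft V S g) (p : M) (X : ℂ) (v : HVec (m + 1)) :
    hopfA (liftStructure H.adapted.smooth g) p X v ∈ line (affineCurve g) p := by
  rw [line_affineCurve, ← ker_projAlong, LinearMap.mem_ker]
  set h := projAlong (g p) v with hh
  set B := offDiag H.adapted.smooth g p h with hB
  have hpd : MDifferentiableAt 𝓘(ℝ, ℂ) 𝓘(ℝ, HVec m) (fun q => projAlong (g q) v) p :=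
    mdifferentiableAt_of_contMDiffOn isOpen_univ
      (contMDiffOn_projAlong H.smooth.contMDiffOn contMDiffOn_const) (Set.mem_univ p)
  have key : ∀ Y : ℂ, projAlong (g p) (nablaEnd (liftStructure H.adapted.smooth g) p Y v) =
      nablaEnd S p Y h + column (nabla g p Y) B := fun Y => by
    have h1 := projAlong_nabla H.smooth (φ := fun _ => v) (p := p) mdifferentiableAt_const Y
    have h0 : nabla (fun _ : M => v) p = 0 := mfderiv_const
    rw [h0, zero_apply, map_zero] at h1
    rw [nablaEnd, H.projAlong_nabla_liftStructure (φ := fun _ => v)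
      ((H.contMDiff_liftStructure v).mdifferentiable (by simp) p),
      nabla_end_apply H.adapted.smooth hpd, ← add_assoc, add_assoc (nablaEnd S p Y _), ← map_add,
      ← h1, map_zero, add_zero]
  have hA : hopfA S p X h = (1 / 4 : ℝ) • (nablaEnd S p (Complex.I * X) h +
    S p (nablaEnd S p X h)) := rfl
  have hS4 : nablaEnd S p (Complex.I * X) h + S p (nablaEnd S p X h) =
      (4 : ℝ) • hopfA S p X h := by
    rw [hA, smul_smul]
    norm_num
  have hreal : ∀ (r : ℝ) (y : HVec (m + 1)), projAlong (g p) (r • y) = r • projAlong (g p) y :=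
    fun r y => ((projAlong (g p)).restrictScalars ℝ).map_smul r y
  rw [hopfA, hreal, map_add, liftStructure, projAlong_blockEnd]
  change (1 / 4 : ℝ) • (projAlong (g p) (nablaEnd (liftStructure H.adapted.smooth g) p _ v) +
    S p (projAlong (g p) (nablaEnd (liftStructure H.adapted.smooth g) p _ v))) = 0
  rw [key, key, map_add, map_column, ← H.star_eq, add_add_add_comm, hS4, H.column_offDiag,
    ← add_smul, smul_add, smul_smul, smul_smul, ← add_smul]
  norm_num

end IsAffineLift

namespace IsAffineLift

variable {M : Type*} [TopologicalSpace M] [ChartedSpace ℂ M] {m : ℕ}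
  {ft : M → HP m} {V : ℕ → M → HSub m} {S : M → HEnd m} {g : M → HVec m}

theorem not_derivVanishesAt_liftFlag_zero (H : IsAffineLift ft V S g) (p : M) :
    ¬ DerivVanishesAt (liftFlag V g 0) p := fun h => by
  have hs : IsSmoothSection (liftFlag V g 0) Set.univ fun q => affinePoint (g q) :=
    ⟨contMDiffOn_affinePoint H.smooth.contMDiffOn, fun q _ => by
      change projAlong (g q) (affinePoint (g q)) ∈ (⊥ : HSub m)
      simp⟩
  have h1 := h _ _ isOpen_univ (Set.mem_univ p) hs 1
  have hmem : nabla (fun q => affinePoint (g q)) p 1 ∈ liftFlag V g 0 p :=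
    (Submodule.Quotient.mk_eq_zero _).1 h1
  have h2 : projAlong (g p) (nabla (fun q => affinePoint (g q)) p 1) ∈ (⊥ : HSub m) := hmem
  rw [projAlong_nabla H.smooth (hs.mdifferentiableAt isOpen_univ (Set.mem_univ p))] at h2
  have h0 : nabla (fun _ : M => (0 : HVec m)) p = 0 := mfderiv_const
  simp only [projAlong_affinePoint, h0, lastL_affinePoint, column_one, zero_apply, zero_add] at h2
  exact H.nabla_one_ne_zero p h2

theorem derivVanishesAt_of_liftFlag_succ (H : IsAffineLift ft V S g) {k : ℕ} {p : M}
    (h : DerivVanishesAt (liftFlag V g (k + 1)) p) : DerivVanishesAt (V k) p := by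
  intro U ψ hU hp hψ X
  have hs : IsSmoothSection (liftFlag V g (k + 1)) U fun q => hyperplaneIncl m (ψ q) :=
    ⟨contMDiffOn_hyperplaneIncl hψ.1, fun q hq => by
      change projAlong (g q) (hyperplaneIncl m (ψ q)) ∈ V k q
      simpa using hψ.2 q hq⟩
  have hmem : nabla (fun q => hyperplaneIncl m (ψ q)) p X ∈ liftFlag V g (k + 1) p :=
    (Submodule.Quotient.mk_eq_zero _).1 (h U _ hU hp hs X)
  have h2 : projAlong (g p) (nabla (fun q => hyperplaneIncl m (ψ q)) p X) ∈ V k p := hmem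
  rw [projAlong_nabla H.smooth (hs.mdifferentiableAt hU hp)] at h2
  simp only [projAlong_hyperplaneIncl, lastL_hyperplaneIncl, map_zero, add_zero] at h2
  exact (Submodule.Quotient.mk_eq_zero _).2 h2

theorem isWeierstrassPoint_of_lift (H : IsAffineLift ft V S g) {p : M}
    (h : IsWeierstrassPoint (liftFlag V g) p) : IsWeierstrassPoint V p := by
  obtain ⟨k, hk, h⟩ := h
  cases k with
  | zero => exact absurd h (H.not_derivVanishesAt_liftFlag_zero p)
  | succ k => exact ⟨k, by omega, H.derivVanishesAt_of_liftFlag_succ h⟩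

variable [IsManifold 𝓘(ℂ) ω M]

theorem isHolomorphicCurve (H : IsAffineLift ft V S g) :
    IsHolomorphicCurve (affineCurve g) := by
  have hl : line (affineCurve g) = liftFlag V g 0 := funext fun p => (liftFlag_zero V g p).symm
  have hS := H.isAdaptedComplexStructure_lift
  rw [IsHolomorphicCurve, hl]
  refine ⟨H.isOsculatingFlag_liftFlag.smooth 0 (Nat.zero_le _),
    liftStructure H.adapted.smooth g,
    fun p v hv => ⟨hS.stable 0 (Nat.zero_le _) p v hv, hS.sq p v⟩, fun U ψ hU hψ => ⟨⟨?_, ?_⟩, ?_⟩⟩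
  · exact contMDiffOn_end_apply hS.smooth hψ.1
  · exact fun p hp => hS.stable 0 (Nat.zero_le _) p _ (hψ.2 p hp)
  · exact hS.star_eq_right 0 (Nat.succ_pos _) U ψ hU hψ

theorem isFrenetWith_affineCurve (H : IsAffineLift ft V S g)
    (hW : ∀ p : M, ∀ᶠ q in 𝓝[≠] p, ¬ IsWeierstrassPoint V q) :
    IsFrenetWith (affineCurve g) (liftFlag V g) (liftStructure H.adapted.smooth g) where
  holomorphic := H.isHolomorphicCurve
  flag := H.isOsculatingFlag_liftFlag
  adapted := H.isAdaptedComplexStructure_lift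
  weierstrass_discrete p := by
    filter_upwards [hW p] with q hq h using hq (H.isWeierstrassPoint_of_lift h)
  canonical := H.hopfA_liftStructure_mem

end IsAffineLift

/-! ### Tangent curve and monodromy -/

section Translation

variable {m : ℕ}

/-- The automorphism of `ℍ^{m+2}` that is the translation by `c` in the affine chart. -/
noncomputable def translation (c : HVec m) : HVec (m + 1) →ₗ[ℍ[ℝ]ᵐᵒᵖ] HVec (m + 1) :=
  LinearMap.id + hyperplaneIncl m ∘ₗ column c ∘ₗ lastL m

theorem translation_apply (c : HVec m) (y : HVec (m + 1)) :
    translation c y = y + hyperplaneIncl m (column c (lastL m y)) := rfl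

theorem translation_zero (y : HVec (m + 1)) : translation (0 : HVec m) y = y := by
  simp [translation_apply, column_apply]

theorem translation_add (c d : HVec m) (y : HVec (m + 1)) :
    translation (c + d) y = translation c (translation d y) := by
  simp only [translation_apply, column_add, map_add, lastL_hyperplaneIncl, map_zero,
    add_zero]
  abel

theorem translation_affinePoint (c g : HVec m) :
    translation c (affinePoint g) = affinePoint (g + c) :=
  ext_init_last (by simp [translation_apply]) (by simp [translation_apply])

/-- Translations as a representation of `ℍ^{m+1}` on `ℍ^{m+2}`. -/
noncomputable def translationHom (m : ℕ) :
    Multiplicative (HVec m) →* (HVec (m + 1) ≃ₗ[ℍ[ℝ]ᵐᵒᵖ] HVec (m + 1)) where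
  toFun c := LinearEquiv.ofLinearMap (translation c.toAdd) (translation (-c.toAdd))
    (LinearMap.ext fun y => by
      rw [LinearMap.comp_apply, ← translation_add, add_neg_cancel, translation_zero]
      rfl)
    (LinearMap.ext fun y => by
      rw [LinearMap.comp_apply, ← translation_add, neg_add_cancel, translation_zero]
      rfl)
  map_one' := LinearEquiv.ext fun y => translation_zero y
  map_mul' c d := LinearEquiv.ext fun y => translation_add c.toAdd d.toAdd y

end Translation

section Geometry

variable {M : Type*} [TopologicalSpace M] [ChartedSpace ℂ M]
  {C : Type*} [TopologicalSpace C] [ChartedSpace ℂ C] {m : ℕ} {π : C → M}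

theorem mdifferentiable_deckTransformation (hπ : IsLocalDiffeomorph 𝓘(ℂ) 𝓘(ℂ) ω π)
    (γ : deckGroup π) : MDifferentiable 𝓘(ℝ, ℂ) 𝓘(ℝ, ℂ) (γ : C ≃ₜ C) := by
  intro x
  have hγ : ∀ y, π ((γ : C ≃ₜ C) y) = π y := γ.2
  obtain ⟨V, U, σ, hV, hU, hx, hxU, hσ, hl, -⟩ := exists_localInverse hπ ((γ : C ≃ₜ C) x)
  rw [hγ] at hxU
  -- near `x`, the deck transformation is `π` followed by a local inverse of `π` at `γ x`
  have e : (γ : C ≃ₜ C) =ᶠ[𝓝 x] σ ∘ π := by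
    filter_upwards [(γ : C ≃ₜ C).continuous.continuousAt.preimage_mem_nhds (hV.mem_nhds hx)]
      with y hy
    rw [Function.comp_apply, ← hγ y, (hl _ hy).2]
  have hd : MDifferentiableAt 𝓘(ℝ, ℂ) 𝓘(ℝ, ℂ) (σ ∘ π) x :=
    ((hσ.contMDiffAt (hU.mem_nhds hxU)).mdifferentiableAt (by simp)).comp x
      ((contMDiff_of_isLocalDiffeomorph hπ).mdifferentiable (by simp) x)
  exact hd.congr_of_eventuallyEq e

/-- A primitive of a pulled back form changes by a constant under a deck transformation. -/
theorem exists_deckTransformation_eq_add [IsManifold 𝓘(ℂ) ω C] [ConnectedSpace C]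
    (hπ : IsLocalDiffeomorph 𝓘(ℂ) 𝓘(ℂ) ω π) {g : C → HVec m} {η : M → (ℂ →L[ℝ] HVec m)}
    (hg : ContMDiff 𝓘(ℝ, ℂ) 𝓘(ℝ, HVec m) ∞ g) (hd : nabla g = pullbackForm π η)
    (γ : deckGroup π) : ∃ c, ∀ x, g ((γ : C ≃ₜ C) x) = g x + c := by
  have hgd : MDifferentiable 𝓘(ℝ, ℂ) 𝓘(ℝ, HVec m) g := hg.mdifferentiable (by simp)
  have hγd := mdifferentiable_deckTransformation hπ γ
  have hγ : ∀ y, π ((γ : C ≃ₜ C) y) = π y := γ.2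
  refine exists_sub_eq_const_of_nabla_eq (ψ := g ∘ (γ : C ≃ₜ C)) (hgd.comp hγd) hgd ?_
  funext x
  have h1 := tangentMapAt_comp (k := π) (h := (γ : C ≃ₜ C)) (x := x)
    ((contMDiff_of_isLocalDiffeomorph hπ).mdifferentiable (by simp) _) (hγd x)
  have h2 : π ∘ (γ : C ≃ₜ C) = π := funext hγ
  rw [h2] at h1
  rw [nabla_comp (hgd _) (hγd x), hd, pullbackForm, pullbackForm, hγ, h1]
  rfl

omit [TopologicalSpace M] [ChartedSpace ℂ M] [ChartedSpace ℂ C] in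
theorem hasMonodromy_affineCurve [Nonempty C] {g : C → HVec m}
    (h : ∀ γ : deckGroup π, ∃ c, ∀ x, g ((γ : C ≃ₜ C) x) = g x + c) :
    HasMonodromy π (affineCurve g) := by
  choose c hc using h
  obtain ⟨x₀⟩ := ‹Nonempty C›
  let τ : deckGroup π →* Multiplicative (HVec m) :=
    { toFun := fun γ => Multiplicative.ofAdd (c γ)
      map_one' := by
        have h1 : g x₀ = g x₀ + c 1 := hc 1 x₀
        rw [left_eq_add.1 h1, ofAdd_zero]
      map_mul' := fun γ γ' => by
        have h1 : g ((γ : C ≃ₜ C) ((γ' : C ≃ₜ C) x₀)) = g x₀ + c (γ * γ') := hc (γ * γ') x₀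
        rw [hc, hc, add_assoc] at h1
        rw [← ofAdd_add, ← add_left_cancel h1, add_comm] }
  refine ⟨(translationHom m).comp τ, fun γ x => ?_⟩
  change line (affineCurve g) _ = Submodule.map (translation (c γ)) (line (affineCurve g) x)
  rw [line_affineCurve, line_affineCurve, Submodule.map_span, Set.image_singleton,
    translation_affinePoint, hc]

theorem IsAffineLift.isTangentCurve [IsManifold 𝓘(ℂ) ω C] {ft : C → HP m} {V : ℕ → C → HSub m}
    {S : C → HEnd m} {g : C → HVec m} (H : IsAffineLift ft V S g)
    (hW : ∀ p : C, ∀ᶠ q in 𝓝[≠] p, ¬ IsWeierstrassPoint V q) :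
    IsTangentCurve (affineCurve g) ft := by
  refine ⟨_, _, H.isFrenetWith_affineCurve hW, fun p => ⟨?_, ?_⟩⟩
  · rw [line_affineCurve, ← ker_projAlong, Submodule.eq_bot_iff]
    rintro _ ⟨hv, v, rfl⟩
    have hv' : projAlong (g p) (hyperplaneIncl m v) = 0 := hv
    rw [projAlong_hyperplaneIncl] at hv'
    rw [hv', map_zero]
  · ext y
    constructor
    · rintro ⟨hv, v, rfl⟩
      have hv' : projAlong (g p) (hyperplaneIncl m v) ∈ V 0 p := hv
      rw [projAlong_hyperplaneIncl, H.flag.zero_eq] at hv'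
      exact ⟨v, hv', rfl⟩
    · rintro ⟨v, hv, rfl⟩
      refine ⟨?_, v, rfl⟩
      change projAlong (g p) (hyperplaneIncl m v) ∈ V 0 p
      rw [projAlong_hyperplaneIncl, H.flag.zero_eq]
      exact hv

/-- A primitive of the pullback of a nowhere vanishing holomorphic form is an affine lift of the
pulled back curve. -/
theorem IsFrenetWith.isAffineLift_comp {ft : M → HP m} {V : ℕ → M → HSub m} {S : M → HEnd m}
    (h : IsFrenetWith ft V S) {η : M → (ℂ →L[ℝ] HVec m)} (hη : IsHolomorphicForm ft S η)
    (hη0 : ∀ p, η p ≠ 0) (hπ : IsLocalDiffeomorph 𝓘(ℂ) 𝓘(ℂ) ω π) {g : C → HVec m}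
    (hg : ContMDiff 𝓘(ℝ, ℂ) 𝓘(ℝ, HVec m) ∞ g) (hd : nabla g = pullbackForm π η) :
    IsAffineLift (ft ∘ π) (fun k => V k ∘ π) (S ∘ π) g where
  flag := h.flag.comp hπ
  adapted := h.adapted.comp hπ
  canonical p X v := by
    rw [hopfA_comp h.adapted.smooth hπ]
    exact h.canonical _ _ _
  smooth := hg
  mem_line p X := by
    rw [hd]
    exact hη.mem_line _ _
  star_eq p X := by
    rw [hd, pullbackForm, ContinuousLinearMap.comp_apply,
      tangentMapAt_I_mul_of_isLocalDiffeomorph hπ]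
    exact hη.star_eq _ _
  ne_zero p h0 := by
    apply hη0 (π p)
    ext1 Y
    obtain ⟨X, rfl⟩ := tangentMapAt_surjective hπ p Y
    rw [hd] at h0
    exact DFunLike.congr_fun h0 X

theorem IsFrenetWith.weierstrass_discrete_comp {ft : M → HP m} {V : ℕ → M → HSub m}
    {S : M → HEnd m} (h : IsFrenetWith ft V S) (hπ : IsLocalDiffeomorph 𝓘(ℂ) 𝓘(ℂ) ω π) (p : C) :
    ∀ᶠ q in 𝓝[≠] p, ¬ IsWeierstrassPoint (fun k => V k ∘ π) q := by
  filter_upwards [(tendsto_punctured_nhds_of_isLocalDiffeomorph hπ p).eventually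
    (h.weierstrass_discrete (π p))] with q hq
  rintro ⟨k, hk, hv⟩
  exact hq ⟨k, hk, hv.of_comp hπ⟩

end Geometry

end FrenetCurves

theorem mainTheorem4
    {M : Type*} [TopologicalSpace M] [T2Space M] [ConnectedSpace M]
    [ChartedSpace ℂ M] [IsManifold 𝓘(ℂ) ω M]
    {C : Type*} [TopologicalSpace C] [T2Space C]
    [ChartedSpace ℂ C] [IsManifold 𝓘(ℂ) ω C]
    (π : C → M) (hπ : FrenetCurves.IsUniversalCovering π)
    (m : ℕ) (ft : M → FrenetCurves.HP m)
    (Vt : ℕ → M → FrenetCurves.HSub m) (St : M → FrenetCurves.HEnd m)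
    (hft : FrenetCurves.IsFrenetWith ft Vt St)
    (η : M → (ℂ →L[ℝ] FrenetCurves.HVec m))
    (hη : FrenetCurves.IsHolomorphicForm ft St η)
    (hη0 : ∀ p, η p ≠ 0) :
    ∃ f : C → FrenetCurves.HP (m + 1),
      (∃ V S, FrenetCurves.IsFrenetWith f V S) ∧
      FrenetCurves.HasMonodromy π f ∧
      FrenetCurves.IsTangentCurve f (ft ∘ π) ∧
      ∃ g : C → FrenetCurves.HVec m,
        ContMDiff 𝓘(ℝ, ℂ) 𝓘(ℝ, FrenetCurves.HVec m) ∞ g ∧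
        FrenetCurves.nabla g = FrenetCurves.pullbackForm π η ∧
        ∀ x, FrenetCurves.line f x =
          Submodule.span ℍ[ℝ]ᵐᵒᵖ {Fin.snoc (α := fun _ => ℍ[ℝ]) (g x) 1} := by
  have := hπ.simplyConnected
  have hloc := hπ.localBiholomorphism
  obtain ⟨g, hg, hd⟩ := ((FrenetCurves.hasLocalPrimitives_of_closed hη.smooth hη.closed).pullback
    (FrenetCurves.contMDiff_of_isLocalDiffeomorph hloc)).exists_primitive
  have H := hft.isAffineLift_comp hη hη0 hloc hg hd
  have hW := hft.weierstrass_discrete_comp hloc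
  exact ⟨FrenetCurves.affineCurve g, ⟨_, _, H.isFrenetWith_affineCurve hW⟩,
    FrenetCurves.hasMonodromy_affineCurve
      (FrenetCurves.exists_deckTransformation_eq_add hloc hg hd),
    H.isTangentCurve hW, g, hg, hd, FrenetCurves.line_affineCurve g⟩
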